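/- Let $\mathbb X$ be a complex Banach space, let $0<\alpha\le 1$, and let $A$ be a bounded linear operator on $\mathbb X$. Let $BUC(\mathbb R^+,\mathbb X)$ be the space of bounded uniformly continuous functions $[0,\infty)\to\mathbb X$ and $C_0(\mathbb R^+,\mathbb X)$ the subspace of those that tend to $0$ at infinity. A function $g\in BUC(\mathbb R^+,\mathbb X)$ is called asymptotic $1$-periodic if $\lim_{t\to\infty}(g(t+1)-g(t))=0$. For continuous $v:[0,\infty)\to\mathbb X$ put $$J^\alpha v(t)=\frac1{\Gamma(\alpha)}\int_0^t (t-\tau)^{\alpha-1}v(\tau)\,d\tau ,\qquad t\ge 0.$$ For $f\in BUC(\mathbb R^+,\mathbb X)$, an asymptotic mild solution of the equation $$D_C^\alpha u(t)=Au(t)+f(t),\qquad t\ge 0, \tag{1}$$ where $D_C^\alpha$ is the Caputo derivative of order $\alpha$, is a function $u\in BUC(\mathbb R^+,\mathbb X)$ for which there is an $\epsilon\in C_0(\mathbb R^+,\mathbb X)$ with $$u(t)=AJ^\alpha u(t)+J^\alpha (f+\epsilon)(t)+u(0)\qquad\text{for all } t\ge 0 .$$ Let $\rho(A,\alpha)$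 be the set of all $\xi_0\in\mathbb C$ such that $\lambda^\alpha-A$ (with the principal branch of $\lambda^\alpha$) has a bounded inverse for all $\lambda$ in a neighbourhood of $\xi_0$ and $(\lambda^\alpha-A)^{-1}$ is analytic in $\lambda$ there, and let $\Sigma_i(A,\alpha)=i\mathbb R\setminus\rho(A,\alpha)$. Assume that the set $e^{\Sigma_i(A,\alpha)}\setminus\{1\}=\{e^{\xi}:\xi\in\Sigma_i(A,\alpha)\}\setminus\{1\}$ is closed and that $f\in BUC(\mathbb R^+,\mathbb X)$ is asymptotic $1$-periodic. Then (1) has an asymptotic mild solution that is asymptotic $1$-periodic if and only if (1) has a (bounded uniformly continuous) asymptotic mild solution. -/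

import Mathlib

open Filter Topology

noncomputable section

/-- The half line `[0, ∞)` is represented by `Set.Ici 0`; the values of a function on the negative
reals never matter. `IsBUC f` says that `f ∈ BUC(ℝ⁺, X)`. -/
def IsBUC {X : Type*} [NormedAddCommGroup X] (f : ℝ → X) : Prop :=
  UniformContinuousOn f (Set.Ici 0) ∧ ∃ C : ℝ, ∀ t : ℝ, 0 ≤ t → ‖f t‖ ≤ C

/-- `f ∈ C₀(ℝ⁺, X)`: `f ∈ BUC(ℝ⁺, X)` and `f(t) → 0` as `t → ∞`. -/
def IsC0 {X : Type*} [NormedAddCommGroup X] (f : ℝ → X) : Prop :=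
  IsBUC f ∧ Tendsto f atTop (𝓝 0)

/-- Asymptotic `1`-periodicity: `f ∈ BUC(ℝ⁺, X)` and `f(t + 1) - f(t) → 0` as `t → ∞`. -/
def IsAsymptoticOnePeriodic {X : Type*} [NormedAddCommGroup X] (f : ℝ → X) : Prop :=
  IsBUC f ∧ Tendsto (fun t : ℝ => f (t + 1) - f t) atTop (𝓝 0)

/-- The Riemann-Liouville fractional integral
`(J^α u)(t) = ∫₀ᵗ (t - τ)^(α - 1) / Γ(α) u(τ) dτ`. -/
def fracIntegral {X : Type*} [NormedAddCommGroup X] [NormedSpace ℂ X]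
    (α : ℝ) (u : ℝ → X) (t : ℝ) : X :=
  ∫ τ in (0 : ℝ)..t, ((t - τ) ^ (α - 1) / Real.Gamma α) • u τ

/-- Mild solutions on `[0, ∞)` of `D_C^α u(t) = A u(t) + f(t)` for an everywhere defined bounded
operator `A` (so that `J^α u(t)` always lies in the domain of `A`). No initial value is fixed. -/
def IsMildSolution {X : Type*} [NormedAddCommGroup X] [NormedSpace ℂ X]
    (α : ℝ) (A : X →L[ℂ] X) (f u : ℝ → X) : Prop :=
  ContinuousOn u (Set.Ici 0) ∧
    ∀ t : ℝ, 0 ≤ t → u t = A (fracIntegral α u t) + fracIntegral α f t + u 0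

/-- Asymptotic mild solutions of `D_C^α u(t) = A u(t) + f(t)`: functions `u ∈ BUC(ℝ⁺, X)` that are
mild solutions of `D_C^α u(t) = A u(t) + f(t) + ε(t)` for some `ε ∈ C₀(ℝ⁺, X)`. -/
def IsAsymptoticMildSolution {X : Type*} [NormedAddCommGroup X] [NormedSpace ℂ X]
    (α : ℝ) (A : X →L[ℂ] X) (f u : ℝ → X) : Prop :=
  IsBUC u ∧ ∃ ε : ℝ → X, IsC0 ε ∧ IsMildSolution α A (fun t => f t + ε t) u

/-- `ρ(A, α)`: the points `ξ` near which `z^α - A` has a bounded two-sided inverse that depends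
analytically on `z`, where `z^α` is the principal branch. -/
def fracResolventSet {X : Type*} [NormedAddCommGroup X] [NormedSpace ℂ X]
    (A : X →L[ℂ] X) (α : ℝ) : Set ℂ :=
  {ξ : ℂ | ∃ R : ℂ → X →L[ℂ] X, AnalyticAt ℂ R ξ ∧
    ∀ᶠ z in 𝓝 ξ,
      (z ^ (α : ℂ) • (1 : X →L[ℂ] X) - A) * R z = 1 ∧
      R z * (z ^ (α : ℂ) • (1 : X →L[ℂ] X) - A) = 1}

/-- `Σ_i(A, α) = iℝ \ ρ(A, α)`. -/
def fracImagSpectrum {X : Type*} [NormedAddCommGroup X] [NormedSpace ℂ X]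
    (A : X →L[ℂ] X) (α : ℝ) : Set ℂ :=
  {ξ : ℂ | ξ.re = 0} \ fracResolventSet A α

end

/-! Only one direction has content: a given solution u must be replaced by an asymptotically
periodic one. This is done by a spectral projection built from unit translations. Say that u has no
spectrum on supp χ if the averages of u against the kernel `𝓕 χ` tend to 0 at infinity.

Away from the integers, u has no spectrum where (2πix)^α - A is invertible
(`tendsto_integral_fourier_of_resolvent`). Convolution with a test kernel turns J^α into division of
the symbol by (2πix)^α, so the symbol χ ((2πix)^α - A)⁻¹ applied to the equation leaves only terms
in f, ε and u(0). The f term vanishes at infinity because off the integers the symbol is divisible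
by e^(2πix) - 1, which differences f.

Since e^Σ \ {1} is closed, a neighbourhood of 1 misses it. Hence all integers have punctured
neighbourhoods of one common radius without spectrum (`exists_radius_isUnit_symbolOp`). Let S be the
unit translation, φ the smooth function on the circle with φ(e^(2πix)) = Σ_n cutoff((x+n)/δ), and P
= φ(S), an absolutely convergent series of translations (`periodization`). What remains of the
spectrum in P u sits at integers. There e^(2πix) - 1 vanishes and, localized at scale δ, has small
Wiener norm, so (S - 1) P u tends to 0 (`tendsto_integral_fourier_of_isolated`,
`tendsto_periodization_forward_diff`).

Finally φ(1) = 1 gives P f - f → 0, and P ε → 0. With G = A u + f + ε, J^α commutes with P up to a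
convergent term: J^α(P G) - P u → l (`exists_tendsto_fracIntegral_periodization`). Then u₁ = J^α(P
G) - l is asymptotic to P u and is a mild solution with initial value -l and a modified ε. -/

open MeasureTheory Set
open scoped FourierTransform ContDiff SchwartzMap

/-! ### Laplace transform of the fractional kernel -/

/-- The Laplace transform of the Riemann-Liouville kernel on the right half plane. -/
lemma laplace_rlKernel {α : ℝ} (hα : 0 < α) {z : ℂ} (hz : 0 < z.re) :
    ∫ r in Ioi (0 : ℝ), (r ^ (α - 1) / Real.Gamma α) • Complex.exp (-z * r)
      = z ^ (-(α : ℂ)) := by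
  have hΓ : 0 < Real.Gamma α := Real.Gamma_pos_of_pos hα
  -- As a complex moment generating function of this measure the left side is holomorphic, so it
  -- suffices to compare on the positive reals, where it is a Gamma integral.
  set μ : Measure ℝ := (volume.restrict (Ioi (0 : ℝ))).withDensity
    (fun r => ENNReal.ofReal (r ^ (α - 1) / Real.Gamma α)) with hμ
  have hmeas : Measurable fun r : ℝ => ENNReal.ofReal (r ^ (α - 1) / Real.Gamma α) := by fun_prop
  have hfin : ∀ᵐ r ∂(volume.restrict (Ioi (0 : ℝ))),
      ENNReal.ofReal (r ^ (α - 1) / Real.Gamma α) < ⊤ := by simp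
  have hset : ∀ t : ℝ, t < 0 → t ∈ interior (ProbabilityTheory.integrableExpSet id μ) := by
    intro t ht
    refine mem_interior.2 ⟨Iio 0, ?_, isOpen_Iio, ht⟩
    intro s hs
    have hs' : 0 < -s := neg_pos.2 hs
    change Integrable (fun r : ℝ => Real.exp (s * r)) μ
    rw [hμ, integrable_withDensity_iff_integrable_smul' hmeas hfin]
    have h := (integrableOn_rpow_mul_exp_neg_mul_rpow (p := 1) (s := α - 1) (b := -s)
      (by linarith) one_pos hs').div_const (Real.Gamma α)
    refine IntegrableOn.congr_fun h (fun r hr => ?_) measurableSet_Ioi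
    have hr : (0 : ℝ) < r := hr
    simp only [Real.rpow_one, smul_eq_mul, neg_neg]
    rw [ENNReal.toReal_ofReal (by positivity)]
    ring
  have hcm : ∀ w : ℂ, ProbabilityTheory.complexMGF id μ w
      = ∫ r in Ioi (0 : ℝ), (r ^ (α - 1) / Real.Gamma α) • Complex.exp (w * r) := by
    intro w
    rw [ProbabilityTheory.complexMGF, hμ, integral_withDensity_eq_integral_toReal_smul hmeas hfin]
    refine setIntegral_congr_fun measurableSet_Ioi (fun r hr => ?_)
    have hr : (0 : ℝ) < r := hr
    simp only [id]
    rw [ENNReal.toReal_ofReal (by positivity)]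
  set U : Set ℂ := {w : ℂ | 0 < w.re}
  have hUo : IsOpen U := isOpen_lt continuous_const Complex.continuous_re
  have h1 : AnalyticOnNhd ℂ (fun w => ProbabilityTheory.complexMGF id μ (-w)) U := by
    refine DifferentiableOn.analyticOnNhd ?_ hUo
    refine (ProbabilityTheory.differentiableOn_complexMGF (X := id) (μ := μ)).comp
      differentiable_neg.differentiableOn ?_
    intro w hw
    have hw : 0 < w.re := hw
    exact hset _ (by simpa using hw)
  have h2 : AnalyticOnNhd ℂ (fun w : ℂ => w ^ (-(α : ℂ))) U := by
    refine DifferentiableOn.analyticOnNhd (fun w hw => ?_) hUo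
    exact (differentiableAt_id.cpow_const (Or.inl hw)).differentiableWithinAt
  have hreal : ∀ x : ℝ, 0 < x → ProbabilityTheory.complexMGF id μ (-(x : ℂ))
      = (x : ℂ) ^ (-(α : ℂ)) := by
    intro x hx
    rw [hcm]
    have h := Real.integral_rpow_mul_exp_neg_mul_Ioi hα hx
    have h3 : ∫ r in Ioi (0 : ℝ), (r ^ (α - 1) / Real.Gamma α) • Complex.exp (-(x : ℂ) * r)
        = ((∫ r in Ioi (0 : ℝ), (r ^ (α - 1) * Real.exp (-(x * r))) / Real.Gamma α : ℝ) : ℂ) := by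
      rw [← integral_complex_ofReal]
      refine integral_congr_ae (Eventually.of_forall fun r => ?_)
      simp only [Complex.real_smul]
      push_cast
      rw [neg_mul]; ring
    rw [h3, integral_div, h, mul_div_assoc, div_self hΓ.ne', mul_one, one_div,
      Real.inv_rpow hx.le, ← Real.rpow_neg hx.le, Complex.ofReal_cpow hx.le]
    simp
  have hfreq : ∃ᶠ w in 𝓝[≠] (1 : ℂ), ProbabilityTheory.complexMGF id μ (-w)
      = w ^ (-(α : ℂ)) := by
    have ht : Tendsto (fun x : ℝ => (x : ℂ)) (𝓝[≠] 1) (𝓝[≠] (1 : ℂ)) := by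
      refine tendsto_nhdsWithin_iff.2 ⟨?_, ?_⟩
      · exact (Complex.continuous_ofReal.tendsto' 1 1 (by simp)).mono_left nhdsWithin_le_nhds
      · filter_upwards [self_mem_nhdsWithin] with x hx
        simpa using hx
    refine ht.frequently (Eventually.frequently ?_)
    filter_upwards [nhdsWithin_le_nhds (lt_mem_nhds (zero_lt_one (α := ℝ)))] with x hx
    exact hreal x hx
  have hUc : IsPreconnected U := (convex_halfSpace_re_gt 0).isPreconnected
  have := h1.eqOn_of_preconnected_of_frequently_eq h2 hUc (by simp [U] : (1 : ℂ) ∈ U) hfreq hz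
  rw [← hcm]
  exact this

/-! ### Fourier transforms of test functions -/

section TestFunctions

variable {V : Type*} [NormedAddCommGroup V] [NormedSpace ℂ V] {F : ℝ → V}

lemma continuous_fourier_of_test (hF : ContDiff ℝ ∞ F) (hc : HasCompactSupport F) :
    Continuous (𝓕 F) :=
  (𝓕 (hc.toSchwartzMap hF)).continuous

lemma integrable_fourier_of_test (hF : ContDiff ℝ ∞ F) (hc : HasCompactSupport F) :
    Integrable (𝓕 F) :=
  (𝓕 (hc.toSchwartzMap hF)).integrable

lemma fourier_decay_of_test (hF : ContDiff ℝ ∞ F) (hc : HasCompactSupport F) (k : ℕ) :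
    ∃ C : ℝ, 0 ≤ C ∧ ∀ s : ℝ, ‖𝓕 F s‖ ≤ C * ((1 + |s|) ^ k)⁻¹ := by
  have h := SchwartzMap.one_add_le_sup_seminorm_apply (𝕜 := ℝ) (m := (k, 0)) (k := k) (n := 0)
    le_rfl le_rfl (𝓕 (hc.toSchwartzMap hF))
  refine ⟨_, (by positivity : (0 : ℝ) ≤ _).trans (h 0), fun s => ?_⟩
  have hs := h s
  have hp : 0 < (1 + |s|) ^ k := by positivity
  rw [← div_eq_mul_inv, le_div_iff₀ hp, mul_comm]
  rw [norm_iteratedFDeriv_zero] at hs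
  exact hs

lemma integral_fourier_of_test [CompleteSpace V] (hF : ContDiff ℝ ∞ F) (hc : HasCompactSupport F) :
    ∫ s, 𝓕 F s = F 0 := by
  have h := congrFun (hF.continuous.fourierInv_fourier_eq (hF.continuous.integrable_of_hasCompactSupport hc)
    (integrable_fourier_of_test hF hc)) 0
  rw [← h, Real.fourierInv_eq']
  simp

end TestFunctions

/-! ### Fourier multiplier of the fractional kernel -/

section RLKernelFourier

variable {V : Type*} [NormedAddCommGroup V] [NormedSpace ℂ V] {α : ℝ}

/-- The singularity at 0 is integrable against a bounded function; beyond 1 the kernel is bounded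
because α ≤ 1, and integrability of `h` takes over. -/
lemma integrableOn_rlKernel_smul (hα0 : 0 < α) (hα1 : α ≤ 1) {h : ℝ → V} {C : ℝ}
    (hi : Integrable h) (hb : ∀ s, ‖h s‖ ≤ C) :
    IntegrableOn (fun r : ℝ => (r ^ (α - 1) / Real.Gamma α) • h r) (Ioi 0) := by
  have hΓ : 0 < Real.Gamma α := Real.Gamma_pos_of_pos hα0
  have hm : AEStronglyMeasurable (fun r : ℝ => (r ^ (α - 1) / Real.Gamma α) • h r) :=
    AEStronglyMeasurable.smul (𝕜 := ℝ) (by fun_prop) hi.aestronglyMeasurable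
  rw [← Ioc_union_Ioi_eq_Ioi (zero_le_one (α := ℝ))]
  refine IntegrableOn.union ?_ ?_
  · have h1 : IntegrableOn (fun r : ℝ => r ^ (α - 1) / Real.Gamma α * C) (Ioc 0 1) :=
      (((intervalIntegrable_iff_integrableOn_Ioc_of_le zero_le_one).1
        (intervalIntegral.intervalIntegrable_rpow' (by linarith))).div_const _).mul_const _
    refine Integrable.mono' h1 hm.restrict ?_
    filter_upwards [ae_restrict_mem measurableSet_Ioc] with r hr
    rw [norm_smul, Real.norm_of_nonneg (by have := hr.1; positivity)]
    have := hr.1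
    exact mul_le_mul_of_nonneg_left (hb r) (by positivity)
  · have h1 : IntegrableOn (fun r : ℝ => 1 / Real.Gamma α * ‖h r‖) (Ioi 1) :=
      (hi.norm.const_mul _).integrableOn
    refine Integrable.mono' h1 hm.restrict ?_
    filter_upwards [ae_restrict_mem measurableSet_Ioi] with r hr
    have hr' : (1 : ℝ) < r := hr
    rw [norm_smul, Real.norm_of_nonneg (by positivity)]
    gcongr
    exact Real.rpow_le_one_of_one_le_of_nonpos hr'.le (by linarith)

lemma integrableOn_rlKernel_exp (hα0 : 0 < α) {σ : ℝ} (hσ : 0 < σ) :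
    IntegrableOn (fun r : ℝ => r ^ (α - 1) / Real.Gamma α * Real.exp (-σ * r)) (Ioi 0) := by
  have h := (integrableOn_rpow_mul_exp_neg_mul_rpow (p := 1) (s := α - 1) (b := σ)
      (by linarith) one_pos hσ).div_const (Real.Gamma α)
  refine IntegrableOn.congr_fun h (fun r _ => ?_) measurableSet_Ioi
  simp only [Real.rpow_one]
  ring

/-- The multiplier `(2πix)^(-α)` is damped by `e^(-σr)` on the kernel side. -/
lemma integral_damped_rlKernel_fourier [CompleteSpace V] (hα0 : 0 < α) {F : ℝ → V}
    (hF : Continuous F) (hc : HasCompactSupport F) {σ : ℝ} (hσ : 0 < σ) (y : ℝ) :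
    ∫ r in Ioi (0 : ℝ), (r ^ (α - 1) / Real.Gamma α * Real.exp (-σ * r)) • 𝓕 F (r + y)
      = ∫ x : ℝ, Complex.exp (↑(-2 * Real.pi * x * y) * Complex.I) •
          ((σ + 2 * Real.pi * x * Complex.I : ℂ) ^ (-(α : ℂ)) • F x) := by
  have hΓ : 0 < Real.Gamma α := Real.Gamma_pos_of_pos hα0
  have hFi : Integrable F := hF.integrable_of_hasCompactSupport hc
  set f : ℝ → ℝ → V := fun r x => (r ^ (α - 1) / Real.Gamma α * Real.exp (-σ * r)) •
      Complex.exp (↑(-2 * Real.pi * x * (r + y)) * Complex.I) • F x with hf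
  -- The damping factor makes the kernel itself integrable, which is what Fubini needs here.
  have hint : Integrable (Function.uncurry f) ((volume.restrict (Ioi (0 : ℝ))).prod volume) := by
    refine Integrable.mono' ((integrableOn_rlKernel_exp hα0 hσ).norm.mul_prod hFi.norm) ?_ ?_
    · refine AEStronglyMeasurable.smul (𝕜 := ℝ) ?_ (AEStronglyMeasurable.smul ?_ ?_)
      · exact (by fun_prop : Measurable fun p : ℝ × ℝ => p.1 ^ (α - 1) / Real.Gamma α
          * Real.exp (-σ * p.1)).aestronglyMeasurable
      · exact (by fun_prop : Continuous fun p : ℝ × ℝ =>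
          Complex.exp (↑(-2 * Real.pi * p.2 * (p.1 + y)) * Complex.I)).aestronglyMeasurable
      · exact (hF.comp continuous_snd).aestronglyMeasurable
    · refine Eventually.of_forall fun p => ?_
      simp only [hf, Function.uncurry, norm_smul, Complex.norm_exp_ofReal_mul_I, one_mul]
      exact le_rfl
  have hL : ∀ r : ℝ, (r ^ (α - 1) / Real.Gamma α * Real.exp (-σ * r)) • 𝓕 F (r + y)
      = ∫ x, f r x := by
    intro r
    rw [Real.fourier_real_eq_integral_exp_smul, ← integral_smul]
  simp_rw [hL]
  rw [integral_integral_swap hint]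
  refine integral_congr_ae (Eventually.of_forall fun x => ?_)
  have hz : 0 < (σ + 2 * Real.pi * x * Complex.I : ℂ).re := by simpa using hσ
  simp only []
  rw [← laplace_rlKernel hα0 hz, ← integral_smul_const, ← integral_smul]
  refine integral_congr_ae (Eventually.of_forall fun r => ?_)
  simp only [hf]
  rw [← Complex.coe_smul, ← Complex.coe_smul, smul_smul, smul_smul, smul_eq_mul]
  congr 1
  push_cast
  rw [mul_assoc, ← Complex.exp_add, mul_left_comm, ← Complex.exp_add]
  ring_nf

/-- Convolving with the Riemann-Liouville kernel multiplies the symbol by `(2πix)^(-α)`. -/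
lemma integral_rlKernel_fourier [CompleteSpace V] (hα0 : 0 < α) (hα1 : α ≤ 1) {F F₁ : ℝ → V}
    (hF : ContDiff ℝ ∞ F) (hc : HasCompactSupport F)
    (hF₁ : Continuous F₁) (hc₁ : HasCompactSupport F₁) (h0 : F₁ 0 = 0)
    (hFF₁ : ∀ x : ℝ, F x = (2 * Real.pi * x * Complex.I : ℂ) ^ (α : ℂ) • F₁ x) (y : ℝ) :
    ∫ r in Ioi (0 : ℝ), (r ^ (α - 1) / Real.Gamma α) • 𝓕 F (r + y) = 𝓕 F₁ y := by
  have hne : (𝓝[>] (0 : ℝ)).NeBot := inferInstance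
  have hΓ : 0 < Real.Gamma α := Real.Gamma_pos_of_pos hα0
  obtain ⟨C, hC0, hC⟩ := fourier_decay_of_test hF hc 0
  have hbd : ∀ s, ‖𝓕 F s‖ ≤ C := fun s => by simpa using hC s
  -- The damped identity is passed to the limit σ → 0+ on both sides; on this side the undamped
  -- integrand dominates.
  have hL : Tendsto (fun σ : ℝ => ∫ r in Ioi (0 : ℝ),
      (r ^ (α - 1) / Real.Gamma α * Real.exp (-σ * r)) • 𝓕 F (r + y)) (𝓝[>] 0)
      (𝓝 (∫ r in Ioi (0 : ℝ), (r ^ (α - 1) / Real.Gamma α) • 𝓕 F (r + y))) := by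
    have hdom := integrableOn_rlKernel_smul hα0 hα1 (h := fun r => 𝓕 F (r + y))
      ((integrable_fourier_of_test hF hc).comp_add_right y) (fun s => hbd _)
    refine tendsto_integral_filter_of_dominated_convergence _ (Eventually.of_forall fun σ => ?_) ?_
      hdom.norm ?_
    · refine AEStronglyMeasurable.smul (𝕜 := ℝ) ?_ ?_
      · exact (by fun_prop : Measurable fun r : ℝ => r ^ (α - 1) / Real.Gamma α
          * Real.exp (-σ * r)).aestronglyMeasurable
      · exact ((continuous_fourier_of_test hF hc).comp
          (continuous_id.add continuous_const)).aestronglyMeasurable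
    · filter_upwards [self_mem_nhdsWithin] with σ hσ
      filter_upwards [ae_restrict_mem measurableSet_Ioi] with r hr
      have hσ : 0 < σ := hσ
      have hr : 0 < r := hr
      rw [norm_smul, norm_smul, norm_mul]
      refine mul_le_mul_of_nonneg_right ?_ (norm_nonneg _)
      refine mul_le_of_le_one_right (norm_nonneg _) ?_
      rw [Real.norm_of_nonneg (Real.exp_pos _).le]
      exact Real.exp_le_one_iff.2 (by nlinarith)
    · refine Eventually.of_forall fun r => ?_
      refine Tendsto.mono_left ?_ nhdsWithin_le_nhds
      refine Continuous.tendsto' (by fun_prop) _ _ ?_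
      simp
  have hR : Tendsto (fun σ : ℝ => ∫ x : ℝ, Complex.exp (↑(-2 * Real.pi * x * y) * Complex.I) •
          ((σ + 2 * Real.pi * x * Complex.I : ℂ) ^ (-(α : ℂ)) • F x)) (𝓝[>] 0) (𝓝 (𝓕 F₁ y)) := by
    rw [Real.fourier_real_eq_integral_exp_smul]
    have hcancel : ∀ x : ℝ, x ≠ 0 →
        (2 * Real.pi * x * Complex.I : ℂ) ^ (-(α : ℂ)) • F x = F₁ x := by
      intro x hx
      have hz : (2 * Real.pi * x * Complex.I : ℂ) ≠ 0 := by
        simp [hx, Real.pi_ne_zero]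
      rw [hFF₁, smul_smul, ← Complex.cpow_add _ _ hz]
      simp
    have hFz : F 0 = 0 := by rw [hFF₁, h0, smul_zero]
    -- Since |σ + 2πix| ≥ |2πix| and the exponent -α is negative, the damped multiplier is at most
    -- the undamped one, which sends `F` to `F₁`.
    refine tendsto_integral_filter_of_dominated_convergence (fun x => ‖F₁ x‖)
      ?_ ?_ (hF₁.integrable_of_hasCompactSupport hc₁).norm ?_
    · filter_upwards [self_mem_nhdsWithin] with σ hσ
      refine Continuous.aestronglyMeasurable ?_
      refine Continuous.smul (by fun_prop) (Continuous.smul ?_ hF.continuous)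
      refine Continuous.cpow (by fun_prop) continuous_const fun x => Or.inl ?_
      simpa using hσ
    · filter_upwards [self_mem_nhdsWithin] with σ hσ
      refine Eventually.of_forall fun x => ?_
      have hσ : 0 < σ := hσ
      rw [norm_smul, Complex.norm_exp_ofReal_mul_I, one_mul]
      rcases eq_or_ne x 0 with rfl | hx
      · simp [hFz]
      rw [← hcancel x hx, norm_smul, norm_smul]
      refine mul_le_mul_of_nonneg_right ?_ (norm_nonneg _)
      have hz : (2 * Real.pi * x * Complex.I : ℂ) ≠ 0 := by
        simp [hx, Real.pi_ne_zero]
      have hz' : (σ + 2 * Real.pi * x * Complex.I : ℂ) ≠ 0 := by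
        intro h
        have := congrArg Complex.re h
        simp at this
        exact hσ.ne' this
      rw [← Complex.ofReal_neg, Complex.norm_cpow_real, Complex.norm_cpow_real]
      refine Real.rpow_le_rpow_of_nonpos (norm_pos_iff.2 hz) ?_ (by linarith)
      have := Complex.abs_im_le_norm (σ + 2 * Real.pi * x * Complex.I : ℂ)
      refine le_trans ?_ this
      simp
    · refine Eventually.of_forall fun x => ?_
      refine Tendsto.mono_left ?_ nhdsWithin_le_nhds
      refine Tendsto.const_smul ?_ _
      rcases eq_or_ne x 0 with rfl | hx
      · simp [hFz, h0]
      rw [← hcancel x hx]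
      refine Tendsto.smul_const ?_ _
      have hs : ((0 : ℝ) + 2 * Real.pi * x * Complex.I : ℂ) ∈ Complex.slitPlane := by
        rw [Complex.mem_slitPlane_iff]
        right
        simp [hx, Real.pi_ne_zero]
      have hcont : ContinuousAt (fun σ : ℝ =>
          (σ + 2 * Real.pi * x * Complex.I : ℂ) ^ (-(α : ℂ))) 0 :=
        ContinuousAt.cpow (by fun_prop) continuousAt_const (by simpa using hs)
      have := hcont.tendsto
      simpa using this
  refine tendsto_nhds_unique hL (hR.congr' ?_)
  filter_upwards [self_mem_nhdsWithin] with σ hσ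
  exact (integral_damped_rlKernel_fourier hα0 hF.continuous hc hσ y).symm

end RLKernelFourier

/-! ### Fractional integrals against test kernels -/

section FracIntegral

variable {X : Type*} [NormedAddCommGroup X] [NormedSpace ℂ X] {α : ℝ}

lemma intervalIntegrable_rlKernel (hα0 : 0 < α) (x a b : ℝ) :
    IntervalIntegrable (fun τ : ℝ => (x - τ) ^ (α - 1) / Real.Gamma α) volume a b := by
  have h := (intervalIntegral.intervalIntegrable_rpow' (a := x - a) (b := x - b)
    (r := α - 1) (by linarith)).comp_sub_left x
  simpa using h.div_const (Real.Gamma α)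

lemma integral_rlKernel (hα0 : 0 < α) (x a b : ℝ) :
    ∫ τ in a..b, (x - τ) ^ (α - 1) / Real.Gamma α
      = ((x - a) ^ α - (x - b) ^ α) / Real.Gamma (α + 1) := by
  rw [intervalIntegral.integral_div,
    intervalIntegral.integral_comp_sub_left (fun y : ℝ => y ^ (α - 1)) x,
    integral_rpow (Or.inl (by linarith)), Real.Gamma_add_one hα0.ne']
  simp only [sub_add_cancel]
  field_simp

lemma intervalIntegrable_rlKernel_smul (hα0 : 0 < α) {v : ℝ → X} {x a b : ℝ}
    (hv : ContinuousOn v (uIcc a b)) :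
    IntervalIntegrable (fun τ : ℝ => ((x - τ) ^ (α - 1) / Real.Gamma α) • v τ) volume a b :=
  (intervalIntegrable_rlKernel hα0 x a b).smul_continuousOn hv

lemma norm_integral_rlKernel_le (hα0 : 0 < α) {v : ℝ → X} {C : ℝ} (hC : ∀ t, ‖v t‖ ≤ C)
    {x a b : ℝ} (hab : a ≤ b) (hbx : b ≤ x) :
    ‖∫ τ in a..b, ((x - τ) ^ (α - 1) / Real.Gamma α) • v τ‖
      ≤ C * (((x - a) ^ α - (x - b) ^ α) / Real.Gamma (α + 1)) := by
  have hΓ : 0 < Real.Gamma α := Real.Gamma_pos_of_pos hα0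
  rw [← integral_rlKernel hα0, ← intervalIntegral.integral_const_mul]
  refine intervalIntegral.norm_integral_le_of_norm_le hab (Eventually.of_forall fun τ hτ => ?_)
    ((intervalIntegrable_rlKernel hα0 x a b).const_mul C)
  have h1 : 0 ≤ x - τ := by linarith [hτ.2]
  have h2 : 0 ≤ (x - τ) ^ (α - 1) / Real.Gamma α := by positivity
  rw [norm_smul, Real.norm_of_nonneg h2, mul_comm]
  exact mul_le_mul_of_nonneg_right (hC τ) h2

/-- The Riemann-Liouville kernel, extended by zero to the negative half line. -/
noncomputable def rlKernel (α r : ℝ) : ℝ := (Ioi (0 : ℝ)).indicator (fun r => r ^ (α - 1) / Real.Gamma α) r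

lemma rlKernel_nonneg (hα0 : 0 < α) (r : ℝ) : 0 ≤ rlKernel α r := by
  have hΓ : 0 < Real.Gamma α := Real.Gamma_pos_of_pos hα0
  refine indicator_nonneg (fun r hr => ?_) r
  have : (0 : ℝ) < r := hr
  positivity

lemma measurable_rlKernel : Measurable (rlKernel α) :=
  Measurable.indicator (by fun_prop) measurableSet_Ioi

lemma rlKernel_of_pos {r : ℝ} (hr : 0 < r) : rlKernel α r = r ^ (α - 1) / Real.Gamma α :=
  indicator_of_mem (mem_Ioi.2 hr) _

lemma rlKernel_of_nonpos {r : ℝ} (hr : r ≤ 0) : rlKernel α r = 0 :=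
  indicator_of_notMem (notMem_Ioi.2 hr) _

/-- With the kernel extended by zero the range of integration no longer depends on s, as required
for Fubini on the quarter plane. -/
lemma setIntegral_rlKernel_smul (v : ℝ → X) {s : ℝ} (hs : 0 < s) :
    ∫ τ in Ioi (0 : ℝ), rlKernel α (s - τ) • v τ = fracIntegral α v s := by
  rw [fracIntegral, intervalIntegral.integral_of_le hs.le, integral_Ioc_eq_integral_Ioo]
  have h : ∫ τ in Ioi (0 : ℝ), rlKernel α (s - τ) • v τ
      = ∫ τ in Ioo (0 : ℝ) s, rlKernel α (s - τ) • v τ := by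
    refine setIntegral_eq_of_subset_of_forall_sdiff_eq_zero measurableSet_Ioi Ioo_subset_Ioi_self ?_
    intro τ hτ
    have : s ≤ τ := by
      by_contra h
      exact hτ.2 ⟨hτ.1, not_le.1 h⟩
    rw [rlKernel_of_nonpos (by linarith), zero_smul]
  rw [h]
  refine setIntegral_congr_fun measurableSet_Ioo fun τ hτ => ?_
  rw [rlKernel_of_pos (sub_pos.2 hτ.2)]

lemma setIntegral_rlKernel (hα0 : 0 < α) {s : ℝ} (hs : 0 < s) :
    ∫ τ in Ioi (0 : ℝ), rlKernel α (s - τ) = s ^ α / Real.Gamma (α + 1) := by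
  have h := setIntegral_rlKernel_smul (α := α) (fun _ => (1 : ℂ)) hs
  have h2 : fracIntegral α (fun _ => (1 : ℂ)) s
      = ((∫ τ in (0 : ℝ)..s, (s - τ) ^ (α - 1) / Real.Gamma α : ℝ) : ℂ) := by
    rw [fracIntegral, ← intervalIntegral.integral_ofReal]
    simp
  rw [h2, integral_rlKernel hα0, sub_zero, sub_self, Real.zero_rpow hα0.ne', sub_zero] at h
  have h3 : ∫ τ in Ioi (0 : ℝ), rlKernel α (s - τ) • (1 : ℂ)
      = ((∫ τ in Ioi (0 : ℝ), rlKernel α (s - τ) : ℝ) : ℂ) := by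
    rw [← integral_complex_ofReal]
    simp
  rw [h3] at h
  exact_mod_cast h

lemma integrableOn_rlKernel_sub (hα0 : 0 < α) {s : ℝ} (hs : 0 < s) :
    IntegrableOn (fun τ => rlKernel α (s - τ)) (Ioi (0 : ℝ)) := by
  by_contra h
  -- A non-integrable function has integral 0 by convention, whereas the value already computed is
  -- positive.
  have h1 := integral_undef h
  rw [setIntegral_rlKernel hα0 hs] at h1
  have : 0 < Real.Gamma (α + 1) := Real.Gamma_pos_of_pos (by linarith)
  have : 0 < s ^ α / Real.Gamma (α + 1) := by positivity
  linarith

/-- Integrating out τ costs a factor s^α, at most linear in s; cubic decay of `k` then leaves an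
integrable bound of order (1 + (s - t)²)⁻¹. -/
lemma integrable_rlKernel_prod (hα0 : 0 < α) (hα1 : α ≤ 1) {k : ℝ → ℝ} (hk : Continuous k)
    {C : ℝ} (hC : ∀ s, ‖k s‖ ≤ C * ((1 + |s|) ^ 3)⁻¹) (t : ℝ) :
    Integrable (fun p : ℝ × ℝ => rlKernel α (p.1 - p.2) * k (p.1 - t))
      ((volume.restrict (Ioi (0 : ℝ))).prod (volume.restrict (Ioi (0 : ℝ)))) := by
  have hΓ : 0 < Real.Gamma (α + 1) := Real.Gamma_pos_of_pos (by linarith)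
  have hC0 : 0 ≤ C := by simpa using (norm_nonneg _).trans (hC 0)
  have hm : AEStronglyMeasurable (fun p : ℝ × ℝ => rlKernel α (p.1 - p.2) * k (p.1 - t))
      ((volume.restrict (Ioi (0 : ℝ))).prod (volume.restrict (Ioi (0 : ℝ)))) := by
    refine Measurable.aestronglyMeasurable (Measurable.mul ?_ ?_)
    · exact measurable_rlKernel.comp (measurable_fst.sub measurable_snd)
    · exact hk.measurable.comp (measurable_fst.sub_const t)
  rw [integrable_prod_iff hm]
  constructor
  · filter_upwards [ae_restrict_mem measurableSet_Ioi] with s hs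
    exact (integrableOn_rlKernel_sub hα0 hs).mul_const _
  · have hb : Integrable (fun s : ℝ => C * (1 + |t|) / Real.Gamma (α + 1) * (1 + (s - t) ^ 2)⁻¹)
        (volume.restrict (Ioi (0 : ℝ))) :=
      ((integrable_inv_one_add_sq.comp_sub_right t).const_mul _).integrableOn
    refine Integrable.mono' hb hm.norm.integral_prod_right' ?_
    filter_upwards [ae_restrict_mem measurableSet_Ioi] with s hs
    have hs : 0 < s := hs
    simp only [norm_mul, Real.norm_of_nonneg (rlKernel_nonneg hα0 _)]
    rw [integral_mul_const, setIntegral_rlKernel hα0 hs, norm_mul, norm_norm,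
      Real.norm_of_nonneg (by positivity)]
    have h1 : s ^ α ≤ 1 + s := by
      rcases le_total s 1 with h | h
      · exact (Real.rpow_le_one hs.le h hα0.le).trans (by linarith)
      · exact (Real.rpow_le_rpow_of_exponent_le h hα1).trans (by rw [Real.rpow_one]; linarith)
    have h2 : 1 + s ≤ (1 + |t|) * (1 + |s - t|) := by
      have := le_abs_self t
      have := le_abs_self (s - t)
      nlinarith [mul_nonneg (abs_nonneg t) (abs_nonneg (s - t))]
    set y := |s - t| with hy
    have hy0 : 0 ≤ y := abs_nonneg _
    have h3 : (s - t) ^ 2 = y ^ 2 := (sq_abs _).symm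
    have h4 : (1 + y) * ((1 + y) ^ 3)⁻¹ ≤ (1 + y ^ 2)⁻¹ := by
      have : (1 + y) * ((1 + y) ^ 3)⁻¹ = ((1 + y) ^ 2)⁻¹ := by field_simp
      rw [this]
      gcongr
      nlinarith
    calc s ^ α / Real.Gamma (α + 1) * ‖k (s - t)‖
        ≤ ((1 + |t|) * (1 + y)) / Real.Gamma (α + 1) * (C * ((1 + y) ^ 3)⁻¹) := by
          gcongr
          · exact h1.trans h2
          · exact hC _
      _ = C * (1 + |t|) / Real.Gamma (α + 1) * ((1 + y) * ((1 + y) ^ 3)⁻¹) := by ring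
      _ ≤ C * (1 + |t|) / Real.Gamma (α + 1) * (1 + (s - t) ^ 2)⁻¹ := by
          rw [h3]
          gcongr

/-- Convolution of a fractional integral with a test kernel divides the symbol by `(2πix)^α`. -/
lemma setIntegral_fourier_fracIntegral [CompleteSpace X] (hα0 : 0 < α) (hα1 : α ≤ 1)
    {F F₁ : ℝ → X →L[ℂ] X}
    (hF : ContDiff ℝ ∞ F) (hc : HasCompactSupport F)
    (hF₁ : Continuous F₁) (hc₁ : HasCompactSupport F₁) (h0 : F₁ 0 = 0)
    (hFF₁ : ∀ x : ℝ, F x = (2 * Real.pi * x * Complex.I : ℂ) ^ (α : ℂ) • F₁ x)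
    {v : ℝ → X} (hv : Continuous v) {C : ℝ} (hC : ∀ t, ‖v t‖ ≤ C) (t : ℝ) :
    ∫ s in Ioi (0 : ℝ), 𝓕 F (s - t) (fracIntegral α v s)
      = ∫ s in Ioi (0 : ℝ), 𝓕 F₁ (s - t) (v s) := by
  obtain ⟨D, hD0, hD⟩ := fourier_decay_of_test hF hc 3
  obtain ⟨D', hD0', hD'⟩ := fourier_decay_of_test hF hc 0
  have hk := continuous_fourier_of_test hF hc
  set f : ℝ → ℝ → X := fun s τ => rlKernel α (s - τ) • (𝓕 F (s - t) (v τ)) with hf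
  have hfm : AEStronglyMeasurable (Function.uncurry f)
      ((volume.restrict (Ioi (0 : ℝ))).prod (volume.restrict (Ioi (0 : ℝ)))) := by
    refine AEStronglyMeasurable.smul (𝕜 := ℝ) ?_ ?_
    · exact (measurable_rlKernel.comp (measurable_fst.sub measurable_snd)).aestronglyMeasurable
    · refine Continuous.aestronglyMeasurable ?_
      exact Continuous.clm_apply (hk.comp (by fun_prop)) (hv.comp continuous_snd)
  have hint : Integrable (Function.uncurry f)
      ((volume.restrict (Ioi (0 : ℝ))).prod (volume.restrict (Ioi (0 : ℝ)))) := by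
    have hb := (integrable_rlKernel_prod hα0 hα1 (k := fun s => ‖𝓕 F s‖) hk.norm
      (fun s => by rw [norm_norm]; exact hD s) t).mul_const C
    refine Integrable.mono' hb hfm (Eventually.of_forall fun p => ?_)
    simp only [hf, Function.uncurry]
    rw [norm_smul, Real.norm_of_nonneg (rlKernel_nonneg hα0 _), mul_assoc]
    refine mul_le_mul_of_nonneg_left ?_ (rlKernel_nonneg hα0 _)
    exact (ContinuousLinearMap.le_opNorm _ _).trans
      (mul_le_mul_of_nonneg_left (hC _) (norm_nonneg _))
  have hL : ∫ s in Ioi (0 : ℝ), 𝓕 F (s - t) (fracIntegral α v s)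
      = ∫ s in Ioi (0 : ℝ), ∫ τ in Ioi (0 : ℝ), f s τ := by
    refine setIntegral_congr_fun measurableSet_Ioi fun s hs => ?_
    have hs : 0 < s := hs
    rw [← setIntegral_rlKernel_smul v hs, ← ContinuousLinearMap.integral_comp_comm]
    · refine integral_congr_ae (Eventually.of_forall fun τ => ?_)
      simp only [hf]
      rw [← Complex.coe_smul, map_smul, Complex.coe_smul]
    · refine Integrable.mono' ((integrableOn_rlKernel_sub hα0 hs).mul_const C) ?_ ?_
      · refine AEStronglyMeasurable.smul (𝕜 := ℝ) ?_ hv.aestronglyMeasurable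
        exact (measurable_rlKernel.comp (by fun_prop)).aestronglyMeasurable
      · refine Eventually.of_forall fun τ => ?_
        rw [norm_smul, Real.norm_of_nonneg (rlKernel_nonneg hα0 _)]
        exact mul_le_mul_of_nonneg_left (hC _) (rlKernel_nonneg hα0 _)
  rw [hL, integral_integral_swap hint]
  refine setIntegral_congr_fun measurableSet_Ioi fun τ hτ => ?_
  have hτ : 0 < τ := hτ
  -- As τ > 0, the kernel already vanishes for s ≤ 0, so the integral is over the whole line and may
  -- be shifted by τ.
  have hshift : ∫ s in Ioi (0 : ℝ), f s τ = ∫ s : ℝ, f s τ := by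
    refine setIntegral_eq_integral_of_forall_compl_eq_zero fun s hs => ?_
    have hs : s ≤ 0 := not_lt.1 hs
    simp only [hf]
    rw [rlKernel_of_nonpos (by linarith), zero_smul]
  rw [hshift, ← integral_add_right_eq_self _ τ]
  have hint2 := integrableOn_rlKernel_smul hα0 hα1 (h := fun r => 𝓕 F (r + (τ - t)))
      ((integrable_fourier_of_test hF hc).comp_add_right (τ - t))
      (C := D') (fun s => by simpa using hD' _)
  rw [← integral_rlKernel_fourier hα0 hα1 hF hc hF₁ hc₁ h0 hFF₁,
    ContinuousLinearMap.integral_apply hint2]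
  rw [← setIntegral_eq_integral_of_forall_compl_eq_zero (s := Ioi 0)]
  · refine setIntegral_congr_fun measurableSet_Ioi fun r hr => ?_
    simp only [hf, add_sub_cancel_right]
    rw [rlKernel_of_pos hr, add_sub_assoc]
    rfl
  · intro r hr
    simp only [hf, add_sub_cancel_right]
    rw [rlKernel_of_nonpos (not_lt.1 hr), zero_smul]

end FracIntegral

/-! ### Averages against integrable kernels at infinity -/

section Kernels

variable {X : Type*} [NormedAddCommGroup X] [NormedSpace ℂ X]

lemma integrable_clm_apply {k : ℝ → X →L[ℂ] X} (hk : Integrable k) {v : ℝ → X}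
    (hv : AEStronglyMeasurable v) {C : ℝ} (hC : ∀ t, ‖v t‖ ≤ C) :
    Integrable (fun s => k s (v s)) := by
  refine Integrable.mono' (hk.norm.mul_const C) ?_ (Eventually.of_forall fun s => ?_)
  · exact (ContinuousLinearMap.id ℂ (X →L[ℂ] X)).aestronglyMeasurable_comp₂
      hk.aestronglyMeasurable hv
  · exact (ContinuousLinearMap.le_opNorm _ _).trans
      (mul_le_mul_of_nonneg_left (hC _) (norm_nonneg _))

lemma tendsto_integral_kernel_zero {k : ℝ → X →L[ℂ] X} (hk : Integrable k) {v : ℝ → X}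
    (hv : StronglyMeasurable v) {C : ℝ} (hC : ∀ t, ‖v t‖ ≤ C) (h0 : Tendsto v atTop (𝓝 0)) :
    Tendsto (fun t => ∫ s, k s (v (t + s))) atTop (𝓝 0) := by
  have h : Tendsto (fun t => ∫ s, k s (v (t + s))) atTop (𝓝 (∫ _ : ℝ, (0 : X))) := by
    refine tendsto_integral_filter_of_dominated_convergence (fun s => ‖k s‖ * C)
      (Eventually.of_forall fun t => ?_) (Eventually.of_forall fun t => ?_)
      (hk.norm.mul_const C) (Eventually.of_forall fun s => ?_)
    · exact (integrable_clm_apply hk (v := fun s => v (t + s))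
        (hv.comp_measurable (measurable_const_add t)).aestronglyMeasurable
        (fun s => hC _)).aestronglyMeasurable
    · exact Eventually.of_forall fun s => (ContinuousLinearMap.le_opNorm _ _).trans
        (mul_le_mul_of_nonneg_left (hC _) (norm_nonneg _))
    · have := (k s).continuous.tendsto 0
      rw [map_zero] at this
      exact this.comp (h0.comp (tendsto_atTop_add_const_right _ _ tendsto_id))
  simpa using h

/-- The difference is the average of `v` restricted to the negative half line, a function vanishing
near +∞. Hence the values given to an extension of `v` to negative times are irrelevant in the
limit. -/
lemma tendsto_integral_kernel_sub_half {k : ℝ → X →L[ℂ] X} (hk : Integrable k) {v : ℝ → X}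
    (hv : Continuous v) {C : ℝ} (hC : ∀ t, ‖v t‖ ≤ C) :
    Tendsto (fun t => (∫ s, k s (v (t + s))) - ∫ s in Ioi (0 : ℝ), k (s - t) (v s))
      atTop (𝓝 0) := by
  have hsm : StronglyMeasurable v := hv.stronglyMeasurable
  have hC0 : 0 ≤ C := (norm_nonneg _).trans (hC 0)
  have hind : ∀ (S : Set ℝ) (s : ℝ), ‖S.indicator v s‖ ≤ C := fun S s =>
    (norm_indicator_le_norm_self _ _).trans (hC s)
  have h := tendsto_integral_kernel_zero hk (v := (Iic (0 : ℝ)).indicator v)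
    (hsm.indicator measurableSet_Iic) (hind _) (by
      refine tendsto_const_nhds.congr' ?_
      filter_upwards [eventually_gt_atTop (0 : ℝ)] with s hs
      rw [indicator_of_notMem (by simpa using hs)])
  refine h.congr fun t => ?_
  have h1 : ∫ s in Ioi (0 : ℝ), k (s - t) (v s)
      = ∫ s, k s ((Ioi (0 : ℝ)).indicator v (t + s)) := by
    rw [← integral_indicator measurableSet_Ioi, ← integral_add_right_eq_self _ t]
    refine integral_congr_ae (Eventually.of_forall fun s => ?_)
    simp only [indicator, add_sub_cancel_right, add_comm t s]
    split_ifs <;> simp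
  rw [h1, ← integral_sub]
  · refine integral_congr_ae (Eventually.of_forall fun s => ?_)
    simp only [indicator, mem_Iic, mem_Ioi]
    by_cases h : 0 < t + s
    · simp [h, not_le.2 h]
    · simp [h, not_lt.1 h]
  · exact integrable_clm_apply hk (v := fun s => v (t + s))
      (hv.comp (continuous_const.add continuous_id)).aestronglyMeasurable fun s => hC _
  · exact integrable_clm_apply hk (v := fun s => (Ioi (0 : ℝ)).indicator v (t + s))
      ((hsm.indicator measurableSet_Ioi).comp_measurable
        (measurable_const_add t)).aestronglyMeasurable fun s => hind _ _

end Kernels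

/-! ### Smoothness, modulation and differencing of symbols -/

section Symbols

variable {V : Type*} [NormedAddCommGroup V] [NormedSpace ℂ V]

lemma contDiff_smul_of_tsupport {χ : ℝ → ℂ} (hχ : ContDiff ℝ ∞ χ) {g : ℝ → V}
    (hg : ∀ x ∈ tsupport χ, ContDiffAt ℝ ∞ g x) : ContDiff ℝ ∞ (fun x => χ x • g x) :=
  contDiff_iff_contDiffAt.2 fun x => by
    by_cases hx : x ∈ tsupport χ
    · exact hχ.contDiffAt.smul (hg x hx)
    · refine contDiffAt_const (c := (0 : V)).congr_of_eventuallyEq ?_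
      filter_upwards [notMem_tsupport_iff_eventuallyEq.1 hx] with y hy
      simp [hy]

lemma contDiffAt_cpow_line (α : ℝ) {x : ℝ} (hx : x ≠ 0) :
    ContDiffAt ℝ ∞ (fun x : ℝ => (2 * Real.pi * x * Complex.I : ℂ) ^ (α : ℂ)) x := by
  have hs : (2 * Real.pi * x * Complex.I : ℂ) ∈ Complex.slitPlane := by
    rw [Complex.mem_slitPlane_iff]
    right
    simp [hx, Real.pi_ne_zero]
  have h1 : ContDiffAt ℝ ∞ (fun z : ℂ => z ^ (α : ℂ)) (2 * Real.pi * x * Complex.I : ℂ) :=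
    ((analyticAt_id.cpow analyticAt_const hs).contDiffAt (n := ∞)).restrict_scalars ℝ
  have h2 : ContDiff ℝ ∞ (fun x : ℝ => (2 * Real.pi * x * Complex.I : ℂ)) := by
    have : ContDiff ℝ ∞ (fun x : ℝ => (x : ℂ)) := Complex.ofRealCLM.contDiff
    fun_prop
  exact h1.comp x h2.contDiffAt

lemma contDiff_exp_line : ContDiff ℝ ∞ (fun x : ℝ => Complex.exp (2 * Real.pi * x * Complex.I)) := by
  have : ContDiff ℝ ∞ (fun x : ℝ => (x : ℂ)) := Complex.ofRealCLM.contDiff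
  fun_prop

lemma exp_line_eq_one_iff (x : ℝ) :
    Complex.exp (2 * Real.pi * x * Complex.I) = 1 ↔ ∃ n : ℤ, x = n := by
  rw [Complex.exp_eq_one_iff]
  refine exists_congr fun n => ?_
  have h : (2 * Real.pi * Complex.I : ℂ) ≠ 0 := by simp [Real.pi_ne_zero]
  rw [show (2 * Real.pi * x * Complex.I : ℂ) = x * (2 * Real.pi * Complex.I) by ring]
  constructor
  · intro h1
    exact_mod_cast mul_right_cancel₀ h h1
  · rintro rfl
    push_cast
    rfl

/-- Modulating the symbol translates the kernel. -/
lemma fourier_exp_line_smul (F : ℝ → V) (a s : ℝ) :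
    𝓕 (fun x : ℝ => Complex.exp (2 * Real.pi * (a * x) * Complex.I) • F x) s = 𝓕 F (s - a) := by
  rw [Real.fourier_real_eq_integral_exp_smul, Real.fourier_real_eq_integral_exp_smul]
  refine integral_congr_ae (Eventually.of_forall fun x => ?_)
  simp only [smul_smul]
  rw [← Complex.exp_add]
  congr 2
  push_cast
  ring

lemma integrable_phase_smul {F : ℝ → V} (hF : Integrable F) {θ : ℝ → ℝ} (hθ : Continuous θ) :
    Integrable (fun x : ℝ => Complex.exp (θ x * Complex.I) • F x) := by
  refine hF.norm.mono' (AEStronglyMeasurable.smul (f := fun x => Complex.exp (θ x * Complex.I))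
    (Continuous.aestronglyMeasurable (by fun_prop)) hF.aestronglyMeasurable)
    (Eventually.of_forall fun x => ?_)
  rw [norm_smul, Complex.norm_exp_ofReal_mul_I, one_mul]

lemma fourier_sub_of_integrable {F G : ℝ → V} (hF : Integrable F) (hG : Integrable G) (s : ℝ) :
    𝓕 (fun x => F x - G x) s = 𝓕 F s - 𝓕 G s := by
  simp only [Real.fourier_real_eq_integral_exp_smul, smul_sub]
  exact integral_sub (integrable_phase_smul hF (by fun_prop))
    (integrable_phase_smul hG (by fun_prop))

/-- Transferred to the function being averaged, this backward difference of the kernel becomes the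
forward difference v(t + 1) - v(t). -/
lemma fourier_exp_line_sub_one_smul {F : ℝ → V} (hF : Integrable F) (s : ℝ) :
    𝓕 (fun x : ℝ => (Complex.exp (2 * Real.pi * x * Complex.I) - 1) • F x) s
      = 𝓕 F (s - 1) - 𝓕 F s := by
  have h := fourier_exp_line_smul F 1 s
  simp only [Complex.ofReal_one, one_mul] at h
  rw [← h]
  simp only [sub_smul, one_smul]
  have hi := integrable_phase_smul hF (θ := fun x => 2 * Real.pi * x) (by fun_prop)
  push_cast at hi
  exact fourier_sub_of_integrable hi hF s

end Symbols

/-! ### The spectrum of a solution away from the integers -/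

section LocalSpectrum

variable {X : Type*} [NormedAddCommGroup X] [NormedSpace ℂ X] {α : ℝ}

/-- The operator `(2πix)^α - A`. -/
noncomputable def symbolOp (α : ℝ) (A : X →L[ℂ] X) (x : ℝ) : X →L[ℂ] X :=
  (2 * Real.pi * x * Complex.I : ℂ) ^ (α : ℂ) • (1 : X →L[ℂ] X) - A

lemma contDiffAt_inverse_symbolOp [CompleteSpace X] (A : X →L[ℂ] X) {x : ℝ} (hx : x ≠ 0)
    (hu : IsUnit (symbolOp α A x)) :
    ContDiffAt ℝ ∞ (fun x => Ring.inverse (symbolOp α A x)) x := by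
  obtain ⟨U, hU⟩ := hu
  have h1 : ContDiffAt ℝ ∞ (fun x => symbolOp α A x) x :=
    ((contDiffAt_cpow_line α hx).smul contDiffAt_const).sub contDiffAt_const
  have h2 : ContDiffAt ℝ ∞ Ring.inverse (symbolOp α A x) := hU ▸ contDiffAt_ringInverse ℝ U
  exact h2.comp x h1

/-- The inverse stands to the left of `A`, so that after multiplication by χ the second term is a
kernel applied to A u. -/
lemma inverse_symbolOp_eq (A : X →L[ℂ] X) {x : ℝ} (hu : IsUnit (symbolOp α A x)) :
    (2 * Real.pi * x * Complex.I : ℂ) ^ (α : ℂ) • Ring.inverse (symbolOp α A x)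
      - Ring.inverse (symbolOp α A x) * A = 1 := by
  have h := Ring.inverse_mul_cancel _ hu
  nth_rewrite 2 [symbolOp] at h
  rw [mul_sub, mul_smul_comm, mul_one] at h
  exact h

lemma tendsto_integral_fourier_of_asymptoticPeriodic {F : ℝ → X →L[ℂ] X}
    (hF : ContDiff ℝ ∞ F) (hc : HasCompactSupport F) {f : ℝ → X} (hf : Continuous f) {C : ℝ}
    (hC : ∀ t, ‖f t‖ ≤ C) (hper : Tendsto (fun t => f (t + 1) - f t) atTop (𝓝 0)) :
    Tendsto (fun t => ∫ s, 𝓕 (fun x : ℝ =>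
      (Complex.exp (2 * Real.pi * x * Complex.I) - 1) • F x) s (f (t + s))) atTop (𝓝 0) := by
  have hk := integrable_fourier_of_test hF hc
  have h := tendsto_integral_kernel_zero hk (v := fun t => f (t + 1) - f t)
    ((hf.comp (continuous_add_const 1)).sub hf).stronglyMeasurable (C := C + C)
    (fun t => (norm_sub_le _ _).trans (add_le_add (hC _) (hC _))) hper
  refine h.congr fun t => ?_
  have hFi : Integrable F := hF.continuous.integrable_of_hasCompactSupport hc
  simp only [fourier_exp_line_sub_one_smul hFi, sub_apply, map_sub]
  have hi : ∀ a b : ℝ, Integrable (fun s => 𝓕 F (s - a) (f (t + s + b))) := fun a b =>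
    integrable_clm_apply (hk.comp_sub_right a) (v := fun s => f (t + s + b))
      (hf.comp (by fun_prop)).aestronglyMeasurable (fun s => hC _)
  rw [integral_sub (by simpa using hi 0 1) (by simpa using hi 0 0),
    integral_sub (by simpa using hi 1 0) (by simpa using hi 0 0)]
  congr 1
  rw [← integral_sub_right_eq_self (fun s => 𝓕 F s (f (t + s + 1))) 1]
  refine integral_congr_ae (Eventually.of_forall fun s => ?_)
  simp only [add_assoc, sub_add_cancel]

/-- A solution has no spectrum where `(2πix)^α - A` is invertible, apart from the integers, which
carry the forcing term. -/
lemma tendsto_integral_fourier_of_resolvent [CompleteSpace X] (hα0 : 0 < α) (hα1 : α ≤ 1) (A : X →L[ℂ] X)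
    {u f ε : ℝ → X} (hu : Continuous u) (hf : Continuous f) (hε : Continuous ε)
    {C : ℝ} (hCu : ∀ t, ‖u t‖ ≤ C) (hCf : ∀ t, ‖f t‖ ≤ C) (hCε : ∀ t, ‖ε t‖ ≤ C)
    (hper : Tendsto (fun t => f (t + 1) - f t) atTop (𝓝 0)) (hε0 : Tendsto ε atTop (𝓝 0))
    (hsol : ∀ t, 0 < t → u t = fracIntegral α (fun s => A (u s) + f s + ε s) t + u 0)
    {χ : ℝ → ℂ} (hχ : ContDiff ℝ ∞ χ) (hχc : HasCompactSupport χ)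
    (hχA : ∀ x ∈ tsupport χ, (∀ n : ℤ, x ≠ n) ∧ IsUnit (symbolOp α A x)) :
    Tendsto (fun t => ∫ s, 𝓕 χ s • u (t + s)) atTop (𝓝 0) := by
  have hne0 : ∀ x ∈ tsupport χ, x ≠ 0 := fun x hx => by simpa using (hχA x hx).1 0
  have hχz : ∀ x, x ∉ tsupport χ → χ x = 0 := fun x hx => image_eq_zero_of_notMem_tsupport hx
  have hχ0 : χ 0 = 0 := hχz 0 fun h => hne0 0 h rfl
  set R : ℝ → X →L[ℂ] X := fun x => Ring.inverse (symbolOp α A x) with hR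
  have hRs : ∀ x ∈ tsupport χ, ContDiffAt ℝ ∞ R x := fun x hx =>
    contDiffAt_inverse_symbolOp A (hne0 x hx) (hχA x hx).2
  -- the three symbols
  set F₁ : ℝ → X →L[ℂ] X := fun x => χ x • R x with hF₁
  set F : ℝ → X →L[ℂ] X := fun x =>
    χ x • ((2 * Real.pi * x * Complex.I : ℂ) ^ (α : ℂ) • R x) with hF
  set F₂ : ℝ → X →L[ℂ] X := fun x =>
    χ x • ((Complex.exp (2 * Real.pi * x * Complex.I) - 1)⁻¹ • R x) with hF₂
  have hF₁s : ContDiff ℝ ∞ F₁ := contDiff_smul_of_tsupport hχ hRs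
  have hF₁c : HasCompactSupport F₁ := hχc.smul_right
  have hFs : ContDiff ℝ ∞ F := contDiff_smul_of_tsupport hχ fun x hx =>
    (contDiffAt_cpow_line α (hne0 x hx)).smul (hRs x hx)
  have hFc : HasCompactSupport F := hχc.smul_right
  have hF₂s : ContDiff ℝ ∞ F₂ := contDiff_smul_of_tsupport hχ fun x hx => by
    refine ContDiffAt.smul (ContDiffAt.inv (𝕜' := ℂ) ?_ ?_) (hRs x hx)
    · exact contDiff_exp_line.contDiffAt.sub contDiffAt_const
    · rw [sub_ne_zero]
      intro h
      obtain ⟨n, hn⟩ := (exp_line_eq_one_iff x).1 h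
      exact (hχA x hx).1 n hn
  have hF₂c : HasCompactSupport F₂ := hχc.smul_right
  have hFF₁ : ∀ x, F x = (2 * Real.pi * x * Complex.I : ℂ) ^ (α : ℂ) • F₁ x := fun x =>
    smul_comm _ _ _
  -- No integer lies in supp χ, so e^(2πix) - 1 can be divided out of `F₁`; this is what removes the
  -- forcing term.
  have hF₁F₂ : F₁ = fun x : ℝ => (Complex.exp (2 * Real.pi * x * Complex.I) - 1) • F₂ x := by
    funext x
    by_cases hx : x ∈ tsupport χ
    · have : Complex.exp (2 * Real.pi * x * Complex.I) - 1 ≠ 0 := by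
        rw [sub_ne_zero]
        intro h
        obtain ⟨n, hn⟩ := (exp_line_eq_one_iff x).1 h
        exact (hχA x hx).1 n hn
      simp only [hF₁, hF₂]
      rw [smul_comm (χ x), smul_smul, mul_inv_cancel₀ this, one_smul]
    · simp [hF₁, hF₂, hχz x hx]
  have hF₁0 : F₁ 0 = 0 := by simp [hF₁, hχ0]
  have hF0 : F 0 = 0 := by simp [hF, hχ0]
  have hFi : Integrable F := hFs.continuous.integrable_of_hasCompactSupport hFc
  have hF₁i : Integrable F₁ := hF₁s.continuous.integrable_of_hasCompactSupport hF₁c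
  have hkF := integrable_fourier_of_test hFs hFc
  have hkF₁ := integrable_fourier_of_test hF₁s hF₁c
  have hkχ := integrable_fourier_of_test hχ hχc
  -- the kernel identity
  have hkey : ∀ s (y : X), 𝓕 χ s • y = 𝓕 F s y - 𝓕 F₁ s (A y) := by
    intro s y
    have h1 : ∀ {G : ℝ → X →L[ℂ] X}, Integrable G → Integrable (fun x : ℝ =>
        Complex.exp (↑(-2 * Real.pi * x * s) * Complex.I) • G x) := fun hG =>
      integrable_phase_smul hG (by fun_prop)
    simp only [Real.fourier_real_eq_integral_exp_smul]
    rw [ContinuousLinearMap.integral_apply (h1 hFi), ContinuousLinearMap.integral_apply (h1 hF₁i),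
      ← integral_smul_const, ← integral_sub ((h1 hFi).apply_continuousLinearMap y)
        ((h1 hF₁i).apply_continuousLinearMap (A y))]
    refine integral_congr_ae (Eventually.of_forall fun x => ?_)
    simp only [smul_apply, smul_eq_mul, mul_smul, ← smul_sub]
    congr 1
    by_cases hx : x ∈ tsupport χ
    · have h2 := congrArg (fun T : X →L[ℂ] X => T y) (inverse_symbolOp_eq A (hχA x hx).2)
      simp only [sub_apply, smul_apply,
        one_apply_eq_self] at h2
      simp only [hF, hF₁, hR, smul_apply, ← smul_sub]
      exact congrArg (χ x • ·) h2.symm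
    · simp [hF, hF₁, hχz x hx]
  -- half line identity
  have hhalf : ∀ t, (∫ s in Ioi (0 : ℝ), 𝓕 χ (s - t) • u s)
      = (∫ s in Ioi (0 : ℝ), 𝓕 F (s - t) (u 0)) + ((∫ s in Ioi (0 : ℝ), 𝓕 F₁ (s - t) (f s))
        + (∫ s in Ioi (0 : ℝ), 𝓕 F₁ (s - t) (ε s))) := by
    intro t
    have hg : Continuous fun s => A (u s) + f s + ε s := by fun_prop
    have hCg : ∀ s, ‖A (u s) + f s + ε s‖ ≤ ‖A‖ * C + C + C := fun s =>
      norm_add₃_le.trans (add_le_add (add_le_add (A.le_of_opNorm_le_of_le le_rfl (hCu s))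
        (hCf s)) (hCε s))
    have hA := setIntegral_fourier_fracIntegral hα0 hα1 hFs hFc hF₁s.continuous hF₁c hF₁0 hFF₁
      hg hCg t
    have hi : ∀ {k : ℝ → X →L[ℂ] X} {v : ℝ → X} {D : ℝ}, Integrable k → Continuous v →
        (∀ s, ‖v s‖ ≤ D) → IntegrableOn (fun s => k (s - t) (v s)) (Ioi 0) :=
      fun hk hv hD => (integrable_clm_apply (hk.comp_sub_right t) hv.aestronglyMeasurable
        hD).integrableOn
    have hAu : ∀ s, ‖A (u s)‖ ≤ ‖A‖ * C := fun s => A.le_of_opNorm_le_of_le le_rfl (hCu s)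
    have hi1 := hi (v := fun s => A (u s)) hkF₁ (A.continuous.comp hu) hAu
    have hi2 := hi hkF₁ hf hCf
    have hi3 := hi hkF₁ hε hCε
    have hi4 := hi hkF hu hCu
    have hi5 := hi hkF (continuous_const (y := u 0)) (fun _ => hCu 0)
    have e1 : (∫ s in Ioi (0 : ℝ), 𝓕 χ (s - t) • u s)
        = (∫ s in Ioi (0 : ℝ), 𝓕 F (s - t) (u s))
          - (∫ s in Ioi (0 : ℝ), 𝓕 F₁ (s - t) (A (u s))) := by
      rw [← integral_sub hi4 hi1]
      exact integral_congr_ae (Eventually.of_forall fun s => hkey _ _)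
    -- The equation enters here: u - u(0) is a fractional integral, and pairing it with the kernel
    -- of `F` replaces `F` by `F₁`.
    have e2 : (∫ s in Ioi (0 : ℝ), 𝓕 F (s - t) (u s)) - (∫ s in Ioi (0 : ℝ), 𝓕 F (s - t) (u 0))
        = (∫ s in Ioi (0 : ℝ), 𝓕 F₁ (s - t) (A (u s) + f s + ε s)) := by
      rw [← hA, ← integral_sub hi4 hi5]
      refine setIntegral_congr_fun measurableSet_Ioi fun s hs => ?_
      simp only [← map_sub]
      congr 1
      nth_rewrite 1 [hsol s hs]
      rw [add_sub_cancel_right]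
    have e3 : (∫ s in Ioi (0 : ℝ), 𝓕 F₁ (s - t) (A (u s) + f s + ε s))
        = (∫ s in Ioi (0 : ℝ), 𝓕 F₁ (s - t) (A (u s))) + (∫ s in Ioi (0 : ℝ), 𝓕 F₁ (s - t) (f s))
          + (∫ s in Ioi (0 : ℝ), 𝓕 F₁ (s - t) (ε s)) := by
      simp only [map_add]
      rw [integral_add (f := fun s => 𝓕 F₁ (s - t) (A (u s)) + 𝓕 F₁ (s - t) (f s)) (hi1.add hi2) hi3, integral_add hi1 hi2]
    -- The A u terms of `e1` and `e3` cancel.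
    rw [e3] at e2
    rw [e1, sub_eq_iff_eq_add.1 e2]
    abel
  -- the limits
  have l1 : Tendsto (fun t => ∫ s in Ioi (0 : ℝ), 𝓕 F (s - t) (u 0)) atTop (𝓝 0) := by
    have h := tendsto_integral_kernel_sub_half hkF (continuous_const (y := u 0)) (fun _ => hCu 0)
    -- The constant u(0) only sees the total mass of the kernel, which is F(0) = 0.
    have h0 : ∫ s, 𝓕 F s (u 0) = 0 := by
      rw [← ContinuousLinearMap.integral_apply hkF, integral_fourier_of_test hFs hFc, hF0]
      simp
    simpa [h0] using h.neg
  have half : ∀ {v : ℝ → X}, Continuous v → (∀ t, ‖v t‖ ≤ C) →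
      Tendsto (fun t => ∫ s, 𝓕 F₁ s (v (t + s))) atTop (𝓝 0) →
      Tendsto (fun t => ∫ s in Ioi (0 : ℝ), 𝓕 F₁ (s - t) (v s)) atTop (𝓝 0) := by
    intro v hv hCv h
    simpa using h.sub (tendsto_integral_kernel_sub_half hkF₁ hv hCv)
  have l2 := half hf hCf (by
    have := tendsto_integral_fourier_of_asymptoticPeriodic hF₂s hF₂c hf hCf hper
    rwa [← hF₁F₂] at this)
  have l3 := half hε hCε (tendsto_integral_kernel_zero hkF₁ hε.stronglyMeasurable hCε hε0)
  have l4 : Tendsto (fun t => ∫ s in Ioi (0 : ℝ), 𝓕 χ (s - t) • u s) atTop (𝓝 0) := by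
    simp_rw [hhalf]
    simpa using l1.add (l2.add l3)
  have hk1 : Integrable (fun s => 𝓕 χ s • (1 : X →L[ℂ] X)) := hkχ.smul_const _
  have l5 := tendsto_integral_kernel_sub_half hk1 hu hCu
  simp only [smul_apply, one_apply_eq_self] at l5
  simpa using l5.add l4

end LocalSpectrum

/-! ### Isolated integer points and the Wiener norm -/

section IsolatedPoint

/-- Submultiplicativity of the Wiener norm: transforms of products are convolutions, and Young's
inequality holds in L¹. Passing to inverse transforms only reflects the argument. -/
lemma integral_norm_fourier_mul_le {a b : ℝ → ℂ} (ha : ContDiff ℝ ∞ a) (hac : HasCompactSupport a)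
    (hb : ContDiff ℝ ∞ b) (hbc : HasCompactSupport b) :
    ∫ s, ‖𝓕 (fun x => a x * b x) s‖ ≤ (∫ s, ‖𝓕 a s‖) * ∫ s, ‖𝓕 b s‖ := by
  set a' : 𝓢(ℝ, ℂ) := hac.toSchwartzMap ha
  set b' : 𝓢(ℝ, ℂ) := hbc.toSchwartzMap hb
  have hneg : ∀ f : ℝ → ℂ, ∫ s, ‖𝓕 f s‖ = ∫ s, ‖𝓕⁻ f s‖ := by
    intro f
    rw [← integral_neg_eq_self (fun s => ‖𝓕 f s‖)]
    simp only [Real.fourierInv_eq_fourier_neg]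
  have hconv : ∀ x, 𝓕⁻ (fun x => a x * b x) x
      = ∫ t, 𝓕⁻ a t * 𝓕⁻ b (x - t) := by
    intro x
    have h := SchwartzMap.convolution_apply (ContinuousLinearMap.mul ℂ ℂ) (𝓕⁻ a') (𝓕⁻ b') x
    have h2 : SchwartzMap.convolution (ContinuousLinearMap.mul ℂ ℂ) (𝓕⁻ a') (𝓕⁻ b')
        = 𝓕⁻ (SchwartzMap.pairing (ContinuousLinearMap.mul ℂ ℂ) a' b') := by
      simp [SchwartzMap.convolution]
    rw [h2, SchwartzMap.fourierInv_coe] at h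
    have h3 : (⇑(SchwartzMap.pairing (ContinuousLinearMap.mul ℂ ℂ) a' b') : ℝ → ℂ)
        = fun x => a x * b x := by
      funext y
      simp [a', b']
    rw [h3] at h
    rw [h]
    simp only [convolution_def, SchwartzMap.fourierInv_coe, ContinuousLinearMap.mul_apply']
    rfl
  have hai : Integrable (𝓕⁻ a) := by
    have := (𝓕⁻ a').integrable (μ := volume)
    rwa [SchwartzMap.fourierInv_coe] at this
  have hbi : Integrable (𝓕⁻ b) := by
    have := (𝓕⁻ b').integrable (μ := volume)
    rwa [SchwartzMap.fourierInv_coe] at this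
  rw [hneg, hneg, hneg]
  have hI := integral_convolution (L := ContinuousLinearMap.mul ℝ ℝ) (μ := volume) (ν := volume)
    hai.norm hbi.norm
  rw [ContinuousLinearMap.mul_apply'] at hI
  rw [← hI]
  refine integral_mono_of_nonneg (Eventually.of_forall fun _ => norm_nonneg _)
    (hai.norm.integrable_convolution (ContinuousLinearMap.mul ℝ ℝ) hbi.norm)
    (Eventually.of_forall fun x => ?_)
  simp only [hconv, convolution_def, ContinuousLinearMap.mul_apply']
  refine (norm_integral_le_integral_norm _).trans_eq ?_
  simp only [norm_mul]

/-- A smooth cutoff equal to `1` on `[-1, 1]` and supported in `[-2, 2]`. -/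
noncomputable def cutoff (x : ℝ) : ℂ :=
  (((⟨1, 2, one_pos, one_lt_two⟩ : ContDiffBump (0 : ℝ)) x : ℝ) : ℂ)

lemma contDiff_cutoff : ContDiff ℝ ∞ cutoff :=
  Complex.ofRealCLM.contDiff.comp (ContDiffBump.contDiff _)

lemma cutoff_eq_one {x : ℝ} (hx : |x| ≤ 1) : cutoff x = 1 := by
  rw [cutoff, ContDiffBump.one_of_mem_closedBall]
  · simp
  · simpa using hx

lemma cutoff_eq_zero {x : ℝ} (hx : 2 ≤ |x|) : cutoff x = 0 := by
  rw [cutoff, ContDiffBump.zero_of_le_dist]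
  · simp
  · simpa using hx

lemma contDiff_cutoff_comp (δ p : ℝ) : ContDiff ℝ ∞ (fun x => cutoff ((x - p) / δ)) :=
  contDiff_cutoff.comp ((contDiff_id.sub contDiff_const).div_const δ)

lemma hasCompactSupport_cutoff_comp {δ : ℝ} (hδ : 0 < δ) (p : ℝ) :
    HasCompactSupport (fun x => cutoff ((x - p) / δ)) := by
  refine HasCompactSupport.intro (isCompact_closedBall p (2 * δ)) fun x hx => cutoff_eq_zero ?_
  rw [Metric.mem_closedBall, Real.dist_eq, not_le] at hx
  rw [abs_div, abs_of_pos hδ, le_div_iff₀ hδ]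
  exact hx.le

lemma hasCompactSupport_cutoff : HasCompactSupport cutoff := by
  simpa using hasCompactSupport_cutoff_comp one_pos 0

lemma fourier_cutoff_comp {δ : ℝ} (hδ : 0 < δ) (p s : ℝ) :
    𝓕 (fun x => cutoff ((x - p) / δ)) s
      = δ * Complex.exp (↑(-2 * Real.pi * p * s) * Complex.I) * 𝓕 cutoff (δ * s) := by
  simp only [Real.fourier_real_eq_integral_exp_smul, smul_eq_mul]
  rw [← integral_add_right_eq_self (fun x : ℝ =>
    Complex.exp (↑(-2 * Real.pi * x * s) * Complex.I) * cutoff ((x - p) / δ)) p]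
  have h := Measure.integral_comp_mul_left (fun x : ℝ =>
    Complex.exp (↑(-2 * Real.pi * (x + p) * s) * Complex.I) * cutoff (x / δ)) δ
  have h2 : ∫ x : ℝ, Complex.exp (↑(-2 * Real.pi * (x + p) * s) * Complex.I)
        * cutoff ((x + p - p) / δ)
      = δ * ∫ x : ℝ, Complex.exp (↑(-2 * Real.pi * (δ * x + p) * s) * Complex.I)
        * cutoff (δ * x / δ) := by
    rw [h, abs_of_pos (inv_pos.2 hδ), Complex.real_smul]
    simp only [add_sub_cancel_right]
    push_cast
    rw [mul_inv_cancel_left₀ (by exact_mod_cast hδ.ne')]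
  rw [h2, mul_assoc,
    ← integral_const_mul (Complex.exp (↑(-2 * Real.pi * p * s) * Complex.I))]
  congr 1
  refine integral_congr_ae (Eventually.of_forall fun x => ?_)
  beta_reduce
  rw [mul_div_cancel_left₀ _ hδ.ne', ← mul_assoc, ← Complex.exp_add]
  congr 2
  push_cast
  ring

/-- Continuity of translation in L¹ by dominated convergence. It makes the Wiener norm of e^(2πix) -
1, cut off at scale δ around an integer, tend to 0 with δ. -/
lemma tendsto_integral_norm_fourier_translate :
    Tendsto (fun δ : ℝ => ∫ s, ‖𝓕 cutoff (s - δ) - 𝓕 cutoff s‖) (𝓝 0) (𝓝 0) := by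
  have hc := continuous_fourier_of_test contDiff_cutoff hasCompactSupport_cutoff
  obtain ⟨D, hD0, hD⟩ := fourier_decay_of_test contDiff_cutoff hasCompactSupport_cutoff 2
  have hb : ∀ δ s : ℝ, |δ| ≤ 1 → ‖𝓕 cutoff (s - δ)‖ ≤ D * (4 * (1 + s ^ 2)⁻¹) := by
    intro δ s hδ
    refine (hD _).trans (mul_le_mul_of_nonneg_left ?_ hD0)
    have h1 : |s| ≤ |s - δ| + |δ| := by
      simpa using abs_add_le (s - δ) δ
    have h0 := abs_nonneg (s - δ)
    have h2 : s ^ 2 = |s| ^ 2 := (sq_abs s).symm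
    rw [← div_eq_mul_inv, inv_le_comm₀ (by positivity) (by positivity), inv_div, h2]
    nlinarith [abs_nonneg s]
  have h : Tendsto (fun δ : ℝ => ∫ s, ‖𝓕 cutoff (s - δ) - 𝓕 cutoff s‖) (𝓝 0)
      (𝓝 (∫ _ : ℝ, (0 : ℝ))) := by
    refine tendsto_integral_filter_of_dominated_convergence
      (fun s => D * (4 * (1 + s ^ 2)⁻¹) + D * (4 * (1 + s ^ 2)⁻¹))
      (Eventually.of_forall fun δ => ?_) ?_ ?_ (Eventually.of_forall fun s => ?_)
    · exact (by fun_prop : Continuous fun s => ‖𝓕 cutoff (s - δ) - 𝓕 cutoff s‖).aestronglyMeasurable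
    · filter_upwards [Metric.closedBall_mem_nhds (0 : ℝ) one_pos] with δ hδ
      refine Eventually.of_forall fun s => ?_
      rw [norm_norm]
      refine (norm_sub_le _ _).trans (add_le_add (hb δ s (by simpa using hδ)) ?_)
      simpa using hb 0 s (by simp)
    · have := (integrable_inv_one_add_sq.const_mul 4).const_mul D
      exact this.add this
    · exact Continuous.tendsto' (by fun_prop) _ _ (by simp)
  simpa using h

/-- Rescaling to unit width preserves the L¹ norm and turns the unit shift into a shift by δ.
Because p is an integer, the phase e^(-2πips) is unaffected by s ↦ s - 1. -/
lemma integral_norm_fourier_exp_line_cutoff {δ : ℝ} (hδ : 0 < δ) (p : ℤ) :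
    ∫ s, ‖𝓕 (fun x : ℝ => (Complex.exp (2 * Real.pi * x * Complex.I) - 1)
      * cutoff ((x - p) / δ)) s‖ = ∫ s, ‖𝓕 cutoff (s - δ) - 𝓕 cutoff s‖ := by
  have hi : Integrable (fun x : ℝ => cutoff ((x - p) / δ)) :=
    (contDiff_cutoff_comp δ p).continuous.integrable_of_hasCompactSupport
      (hasCompactSupport_cutoff_comp hδ p)
  have h := Measure.integral_comp_mul_left (fun s : ℝ => ‖𝓕 cutoff (s - δ) - 𝓕 cutoff s‖) δ
  have h2 : ∫ s, ‖𝓕 cutoff (s - δ) - 𝓕 cutoff s‖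
      = δ * ∫ s, ‖𝓕 cutoff (δ * s - δ) - 𝓕 cutoff (δ * s)‖ := by
    rw [h, abs_of_pos (inv_pos.2 hδ), smul_eq_mul, mul_inv_cancel_left₀ hδ.ne']
  rw [h2, ← integral_const_mul]
  refine integral_congr_ae (Eventually.of_forall fun s => ?_)
  have h3 := fourier_exp_line_sub_one_smul hi s
  simp only [smul_eq_mul] at h3
  beta_reduce
  rw [h3, fourier_cutoff_comp hδ, fourier_cutoff_comp hδ]
  have h4 : Complex.exp (↑(-2 * Real.pi * (p : ℝ) * (s - 1)) * Complex.I)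
      = Complex.exp (↑(-2 * Real.pi * (p : ℝ) * s) * Complex.I) := by
    rw [Complex.exp_eq_exp_iff_exists_int]
    refine ⟨p, ?_⟩
    push_cast
    ring
  rw [h4, ← mul_sub, norm_mul, norm_mul, Complex.norm_exp_ofReal_mul_I, Complex.norm_real,
    Real.norm_of_nonneg hδ.le, mul_one, mul_sub, mul_one]

variable {X : Type*} [NormedAddCommGroup X] [NormedSpace ℂ X]

lemma integrable_smul_translate {k : ℝ → ℂ} (hk : Integrable k) {u : ℝ → X} (hu : Continuous u)
    {C : ℝ} (hC : ∀ t, ‖u t‖ ≤ C) (t : ℝ) : Integrable (fun s => k s • u (t + s)) := by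
  refine (hk.norm.mul_const C).mono' (hk.aestronglyMeasurable.smul
    (hu.comp (continuous_const.add continuous_id)).aestronglyMeasurable)
    (Eventually.of_forall fun s => ?_)
  rw [norm_smul]
  exact mul_le_mul_of_nonneg_left (hC _) (norm_nonneg _)

lemma norm_integral_smul_translate_le {k : ℝ → ℂ} (hk : Integrable k) {u : ℝ → X}
    {C : ℝ} (hC : ∀ t, ‖u t‖ ≤ C) (t : ℝ) :
    ‖∫ s, k s • u (t + s)‖ ≤ (∫ s, ‖k s‖) * C := by
  rw [← integral_mul_const]
  refine norm_integral_le_of_norm_le (hk.norm.mul_const C) (Eventually.of_forall fun s => ?_)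
  rw [norm_smul]
  exact mul_le_mul_of_nonneg_left (hC _) (norm_nonneg _)

/-- An isolated integer point of the spectrum is annihilated by any symbol divisible by
`e^(2πix) - 1`. -/
lemma tendsto_integral_fourier_of_isolated {u : ℝ → X} (hu : Continuous u) {C : ℝ}
    (hC : ∀ t, ‖u t‖ ≤ C) {p : ℤ} {S : Set ℝ}
    (hloc : ∀ χ : ℝ → ℂ, ContDiff ℝ ∞ χ → HasCompactSupport χ → tsupport χ ⊆ S \ {(p : ℝ)} →
      Tendsto (fun t => ∫ s, 𝓕 χ s • u (t + s)) atTop (𝓝 0))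
    {a : ℝ → ℂ} (ha : ContDiff ℝ ∞ a) (hac : HasCompactSupport a) (haS : tsupport a ⊆ S) :
    Tendsto (fun t => ∫ s, 𝓕 (fun x : ℝ =>
      (Complex.exp (2 * Real.pi * x * Complex.I) - 1) * a x) s • u (t + s)) atTop (𝓝 0) := by
  have hC0 : 0 ≤ C := (norm_nonneg _).trans (hC 0)
  set e : ℝ → ℂ := fun x => Complex.exp (2 * Real.pi * x * Complex.I) - 1 with he
  have hes : ContDiff ℝ ∞ e := contDiff_exp_line.sub contDiff_const
  rw [Metric.tendsto_atTop']
  intro η hη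
  have hlim : Tendsto (fun δ : ℝ => (∫ s, ‖𝓕 a s‖) * (∫ s, ‖𝓕 cutoff (s - δ) - 𝓕 cutoff s‖) * C)
      (𝓝[>] 0) (𝓝 0) := by
    simpa using ((tendsto_integral_norm_fourier_translate.const_mul _).mul_const C).mono_left
      nhdsWithin_le_nhds
  obtain ⟨δ, hδη, hδ⟩ := ((hlim.eventually_lt_const (half_pos hη)).and
    self_mem_nhdsWithin).exists
  have hδ : 0 < δ := hδ
  set b : ℝ → ℂ := fun x => cutoff ((x - p) / δ) with hb
  have hbs : ContDiff ℝ ∞ b := contDiff_cutoff_comp δ p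
  have hbc : HasCompactSupport b := hasCompactSupport_cutoff_comp hδ p
  have hebs : ContDiff ℝ ∞ (fun x => e x * b x) := hes.mul hbs
  have hebc : HasCompactSupport (fun x => e x * b x) := hbc.mul_left
  -- The symbol `e * a` is split by the cutoff `b` at scale δ: this part vanishes near p and falls
  -- under `hloc`, while the rest, `ψ`, has Wiener norm as small as δ was chosen to make it.
  set χ : ℝ → ℂ := fun x => e x * a x * (1 - b x) with hχ
  have hχs : ContDiff ℝ ∞ χ := (hes.mul ha).mul (contDiff_const.sub hbs)
  have hχc : HasCompactSupport χ := hac.mul_left.mul_right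
  have hχS : tsupport χ ⊆ S \ {(p : ℝ)} := by
    intro x hx
    refine ⟨haS ?_, ?_⟩
    · have h1 : tsupport χ ⊆ tsupport a := by
        refine closure_mono fun y hy => ?_
        rw [Function.mem_support] at hy ⊢
        intro h
        exact hy (by simp [hχ, h])
      exact h1 hx
    · rintro rfl
      refine (notMem_tsupport_iff_eventuallyEq.2 ?_) hx
      filter_upwards [Metric.ball_mem_nhds (p : ℝ) hδ] with y hy
      have : b y = 1 := by
        refine cutoff_eq_one ?_
        rw [abs_div, abs_of_pos hδ, div_le_one hδ]
        rw [Metric.mem_ball, Real.dist_eq] at hy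
        exact hy.le
      simp [hχ, this]
  set ψ : ℝ → ℂ := fun x => a x * (e x * b x) with hψ
  have hψs : ContDiff ℝ ∞ ψ := ha.mul hebs
  have hψc : HasCompactSupport ψ := hac.mul_right
  obtain ⟨T, hT⟩ := (Metric.tendsto_atTop'.1 (hloc χ hχs hχc hχS)) (η / 2) (half_pos hη)
  refine ⟨T, fun t ht => ?_⟩
  have h1 := hT t ht
  rw [dist_zero_right] at h1 ⊢
  change ‖∫ s, 𝓕 (fun x => e x * a x) s • u (t + s)‖ < η
  have hsum : ∀ s, 𝓕 (fun x => e x * a x) s = 𝓕 χ s + 𝓕 ψ s := by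
    intro s
    have h := fourier_sub_of_integrable
      ((hes.mul ha).continuous.integrable_of_hasCompactSupport hac.mul_left)
      (hψs.continuous.integrable_of_hasCompactSupport hψc) s
    rw [← sub_eq_iff_eq_add, ← h]
    refine congrArg (fun g : ℝ → ℂ => 𝓕 g s) (funext fun x => ?_)
    simp only [hχ, hψ]
    ring
  have hkχ := integrable_fourier_of_test hχs hχc
  have hkψ := integrable_fourier_of_test hψs hψc
  simp only [hsum, add_smul]
  rw [integral_add (integrable_smul_translate hkχ hu hC t) (integrable_smul_translate hkψ hu hC t)]
  have h2 : ‖∫ s, 𝓕 ψ s • u (t + s)‖ < η / 2 := by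
    refine (norm_integral_smul_translate_le hkψ hC t).trans_lt (lt_of_le_of_lt ?_ hδη)
    refine mul_le_mul_of_nonneg_right ?_ hC0
    rw [← integral_norm_fourier_exp_line_cutoff hδ p]
    exact integral_norm_fourier_mul_le ha hac hebs hebc
  refine (norm_add_le _ _).trans_lt ?_
  linarith

end IsolatedPoint

/-! ### Periodization and recovery from band limited averages -/

section Periodization

lemma contDiff_cutoff_div (δ : ℝ) : ContDiff ℝ ∞ (fun x => cutoff (x / δ)) := by
  simpa using contDiff_cutoff_comp δ 0

lemma hasCompactSupport_cutoff_div {δ : ℝ} (hδ : 0 < δ) :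
    HasCompactSupport (fun x => cutoff (x / δ)) := by
  simpa using hasCompactSupport_cutoff_comp hδ 0

lemma cutoff_div_eq_zero {δ : ℝ} (hδ : 0 < δ) {x : ℝ} (hx : 2 * δ ≤ |x|) :
    cutoff (x / δ) = 0 := by
  refine cutoff_eq_zero ?_
  rwa [abs_div, abs_of_pos hδ, le_div_iff₀ hδ]

/-- Fourier coefficients of the `1`-periodization of `cutoff (x / δ)`. -/
noncomputable def periodCoeff (δ : ℝ) (m : ℤ) : ℂ := 𝓕 (fun x => cutoff (x / δ)) (m : ℝ)

/-- The weight 1 + |m| will absorb the error made in commuting J^α with translation by m, which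
grows like |m|^α. -/
lemma summable_periodCoeff_mul {δ : ℝ} (hδ : 0 < δ) :
    Summable (fun m : ℤ => ‖periodCoeff δ m‖ * (1 + |(m : ℝ)|)) := by
  obtain ⟨D, hD0, hD⟩ := fourier_decay_of_test (contDiff_cutoff_div δ)
    (hasCompactSupport_cutoff_div hδ) 3
  have h1 : Summable (fun m : ℤ => D * (|(m : ℝ)| ^ (-2 : ℝ))) :=
    (Real.summable_abs_int_rpow one_lt_two).mul_left D
  refine Summable.of_norm_bounded_eventually h1 ?_
  filter_upwards [(finite_singleton (0 : ℤ)).compl_mem_cofinite] with m hm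
  have hm : m ≠ 0 := hm
  have hm' : 0 < |(m : ℝ)| := by positivity
  rw [Real.norm_of_nonneg (by positivity)]
  set y := |(m : ℝ)|
  calc ‖periodCoeff δ m‖ * (1 + y) ≤ D * ((1 + y) ^ 3)⁻¹ * (1 + y) := by
        gcongr
        exact hD m
    _ = D * ((1 + y) ^ 2)⁻¹ := by field_simp
    _ ≤ D * y ^ (-2 : ℝ) := by
        rw [Real.rpow_neg hm'.le, Real.rpow_two]
        gcongr
        linarith

lemma summable_norm_periodCoeff {δ : ℝ} (hδ : 0 < δ) :
    Summable (fun m : ℤ => ‖periodCoeff δ m‖) := by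
  refine (summable_periodCoeff_mul hδ).of_nonneg_of_le (fun _ => norm_nonneg _) fun m => ?_
  refine le_mul_of_one_le_right (norm_nonneg _) ?_
  linarith [abs_nonneg (m : ℝ)]

/-- Poisson summation: the right side is the Fourier multiplier of `periodization δ`. -/
lemma tsum_periodCoeff_mul_exp {δ : ℝ} (hδ : 0 < δ) (x : ℝ) :
    ∑' m : ℤ, periodCoeff δ m * Complex.exp (2 * Real.pi * (m * x) * Complex.I)
      = ∑' n : ℤ, cutoff ((x + n) / δ) := by
  have h := SchwartzMap.tsum_eq_tsum_fourier
    ((hasCompactSupport_cutoff_div hδ).toSchwartzMap (contDiff_cutoff_div δ)) x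
  simp only [HasCompactSupport.toSchwartzMap_toFun] at h
  rw [h]
  refine tsum_congr fun m => ?_
  rw [SchwartzMap.fourier_coe, fourier_coe_apply]
  congr 2
  push_cast
  ring

/-- The multiplier at x = 0; as 2δ ≤ 1, only the bump n = 0 reaches that point. -/
lemma tsum_periodCoeff {δ : ℝ} (hδ : 0 < δ) (hδ1 : 2 * δ ≤ 1) : ∑' m : ℤ, periodCoeff δ m = 1 := by
  have h := tsum_periodCoeff_mul_exp hδ 0
  simp only [Complex.ofReal_zero, mul_zero, zero_mul, Complex.exp_zero, mul_one, zero_add] at h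
  rw [h, tsum_eq_single 0]
  · exact cutoff_eq_one (by simp)
  · intro n hn
    refine cutoff_div_eq_zero hδ (hδ1.trans ?_)
    exact_mod_cast Int.one_le_abs hn

variable {X : Type*} [NormedAddCommGroup X] [NormedSpace ℂ X]

/-- The smooth function of the unit translation with coefficients `periodCoeff δ`. -/
noncomputable def periodization (δ : ℝ) (v : ℝ → X) (t : ℝ) : X :=
  ∑' m : ℤ, periodCoeff δ m • v (t + m)

lemma norm_tsum_periodCoeff_smul_le {δ : ℝ} (hδ : 0 < δ) {y : ℤ → X} {C : ℝ}
    (hC : ∀ m, ‖y m‖ ≤ C) :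
    ‖∑' m : ℤ, periodCoeff δ m • y m‖ ≤ (∑' m : ℤ, ‖periodCoeff δ m‖) * C := by
  rw [← tsum_mul_right]
  refine tsum_of_norm_bounded ((summable_norm_periodCoeff hδ).mul_right C).hasSum fun m => ?_
  rw [norm_smul]
  exact mul_le_mul_of_nonneg_left (hC m) (norm_nonneg _)

variable [CompleteSpace X]

lemma summable_periodCoeff_smul {δ : ℝ} (hδ : 0 < δ) {y : ℤ → X} {C : ℝ}
    (hC : ∀ m, ‖y m‖ ≤ C) : Summable (fun m : ℤ => periodCoeff δ m • y m) := by
  refine Summable.of_norm_bounded ((summable_norm_periodCoeff hδ).mul_right C) fun m => ?_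
  rw [norm_smul]
  exact mul_le_mul_of_nonneg_left (hC m) (norm_nonneg _)

lemma uniformContinuous_periodization {δ : ℝ} (hδ : 0 < δ) {v : ℝ → X} (hv : UniformContinuous v)
    {C : ℝ} (hC : ∀ t, ‖v t‖ ≤ C) : UniformContinuous (periodization δ v) := by
  set S := ∑' m : ℤ, ‖periodCoeff δ m‖ with hS
  have hS0 : 0 ≤ S := tsum_nonneg fun _ => norm_nonneg _
  rw [Metric.uniformContinuous_iff] at hv ⊢
  intro η hη
  obtain ⟨ρ, hρ, h⟩ := hv (η / (S + 1)) (by positivity)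
  refine ⟨ρ, hρ, fun {a b} hab => ?_⟩
  rw [dist_eq_norm, periodization, periodization,
    ← (summable_periodCoeff_smul hδ fun m => hC _).tsum_sub
      (summable_periodCoeff_smul hδ fun m => hC _)]
  simp only [← smul_sub]
  refine (norm_tsum_periodCoeff_smul_le hδ (C := η / (S + 1)) fun m => ?_).trans_lt ?_
  · rw [← dist_eq_norm]
    exact (h (by simpa using hab)).le
  · rw [← hS, ← mul_div_assoc, div_lt_iff₀ (by positivity)]
    nlinarith


lemma tendsto_periodization_zero {δ : ℝ} (hδ : 0 < δ) {v : ℝ → X} {C : ℝ} (hC : ∀ t, ‖v t‖ ≤ C)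
    (h0 : Tendsto v atTop (𝓝 0)) : Tendsto (periodization δ v) atTop (𝓝 0) := by
  have h : Tendsto (periodization δ v) atTop (𝓝 (∑' _ : ℤ, (0 : X))) := by
    refine tendsto_tsum_of_dominated_convergence
      ((summable_norm_periodCoeff hδ).mul_right C) (fun m => ?_)
      (Eventually.of_forall fun t m => ?_)
    · simpa using (h0.comp (tendsto_atTop_add_const_right _ (m : ℝ) tendsto_id)).const_smul
        (periodCoeff δ m)
    · rw [norm_smul]
      exact mul_le_mul_of_nonneg_left (hC _) (norm_nonneg _)
  simpa using h

/-- A bounded uniformly continuous function vanishes at infinity as soon as its band limited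
regularizations do. -/
lemma tendsto_zero_of_bandlimited {v : ℝ → X} (hv : UniformContinuous v) {C : ℝ}
    (hC : ∀ t, ‖v t‖ ≤ C)
    (h : ∀ N : ℝ, 0 < N →
      Tendsto (fun t => ∫ s, 𝓕 (fun x => cutoff (x / N)) s • v (t + s)) atTop (𝓝 0)) :
    Tendsto v atTop (𝓝 0) := by
  have hC0 : 0 ≤ C := (norm_nonneg _).trans (hC 0)
  set k : ℝ → ℂ := 𝓕 cutoff with hk
  have hki : Integrable k := integrable_fourier_of_test contDiff_cutoff hasCompactSupport_cutoff
  have hki1 : Integrable (fun s => |s| * ‖k s‖) := by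
    have := (𝓕 (hasCompactSupport_cutoff.toSchwartzMap contDiff_cutoff)).integrable_pow_mul
      volume 1
    simpa [SchwartzMap.fourier_coe] using! this
  have hk1 : ∫ s, k s = 1 := by
    rw [hk, integral_fourier_of_test contDiff_cutoff hasCompactSupport_cutoff]
    exact cutoff_eq_one (by simp)
  set S := ∫ s, ‖k s‖
  set S1 := ∫ s, |s| * ‖k s‖
  have hS0 : 0 ≤ S := integral_nonneg fun _ => norm_nonneg _
  have hS10 : 0 ≤ S1 := integral_nonneg fun _ => by positivity
  rw [Metric.tendsto_atTop']
  intro η hη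
  obtain ⟨ρ, hρ, hmod⟩ := Metric.uniformContinuous_iff.1 hv (η / (4 * (S + 1))) (by positivity)
  set η' := η / (4 * (S + 1)) with hη'
  set K := 2 * C / ρ with hK
  have hK0 : 0 ≤ K := by positivity
  -- Uniform continuity controls |y| < ρ, and for larger |y| the trivial bound 2C is absorbed by
  -- K|y|. A bound affine in |y| can be integrated against the kernel using only its first moment.
  have hmod' : ∀ x y : ℝ, ‖v (x + y) - v x‖ ≤ η' + K * |y| := by
    intro x y
    rcases lt_or_ge |y| ρ with hy | hy
    · have := hmod (a := x + y) (b := x) (by simpa using hy)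
      rw [dist_eq_norm] at this
      have : 0 ≤ K * |y| := by positivity
      linarith
    · have h1 : ‖v (x + y) - v x‖ ≤ 2 * C := by
        refine (norm_sub_le _ _).trans ?_
        linarith [hC (x + y), hC x]
      have h2 : 2 * C ≤ K * |y| := by
        rw [hK, div_mul_eq_mul_div, le_div_iff₀ hρ]
        gcongr
      have : 0 ≤ η' := by positivity
      linarith
  -- Chosen so that the first moment contributes K S1 / N ≤ η/4; the constant `η'` contributes
  -- another η/4, and so does the band limited average.
  set N : ℝ := 4 * (K * S1 + 1) / η with hN
  have hN0 : 0 < N := by positivity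
  obtain ⟨T, hT⟩ := (Metric.tendsto_atTop'.1 (h N hN0)) (η / 4) (by positivity)
  refine ⟨T, fun t ht => ?_⟩
  have h1 := hT t ht
  rw [dist_zero_right] at h1 ⊢
  have hcv : Continuous v := hv.continuous
  -- The kernel at bandwidth N is `k` rescaled, an approximate identity as N grows.
  have hsub : ∫ s, 𝓕 (fun x => cutoff (x / N)) s • v (t + s) = ∫ s, k s • v (t + s / N) := by
    have e1 := Measure.integral_comp_mul_left (fun s : ℝ => k s • v (t + s / N)) N
    have e2 : ∫ s, k s • v (t + s / N) = N • ∫ s, k (N * s) • v (t + N * s / N) := by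
      rw [e1, abs_of_pos (inv_pos.2 hN0), smul_smul, mul_inv_cancel₀ hN0.ne', one_smul]
    rw [e2, ← integral_smul]
    refine integral_congr_ae (Eventually.of_forall fun s => ?_)
    have e3 := fourier_cutoff_comp hN0 0 s
    simp only [sub_zero, mul_zero, zero_mul, Complex.ofReal_zero, Complex.exp_zero, mul_one] at e3
    beta_reduce
    rw [e3, mul_div_cancel_left₀ _ hN0.ne', mul_smul, Complex.coe_smul]
  have hi : Integrable (fun s => k s • v (t + s / N)) := by
    refine (hki.norm.mul_const C).mono' (hki.aestronglyMeasurable.smul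
      (hcv.comp (by fun_prop)).aestronglyMeasurable) (Eventually.of_forall fun s => ?_)
    rw [norm_smul]
    exact mul_le_mul_of_nonneg_left (hC _) (norm_nonneg _)
  have hdiff : ‖(∫ s, k s • v (t + s / N)) - v t‖ ≤ S * η' + K / N * S1 := by
    have e1 : (∫ s, k s • v (t + s / N)) - v t = ∫ s, k s • (v (t + s / N) - v t) := by
      simp only [smul_sub]
      rw [integral_sub hi (hki.smul_const _), integral_smul_const, hk1, one_smul]
    have e2 : S * η' + K / N * S1 = ∫ s, (‖k s‖ * η' + K / N * (|s| * ‖k s‖)) := by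
      rw [integral_add (hki.norm.mul_const _) (hki1.const_mul _), integral_mul_const,
        integral_const_mul]
    rw [e1, e2]
    refine norm_integral_le_of_norm_le ((hki.norm.mul_const _).add (hki1.const_mul _))
      (Eventually.of_forall fun s => ?_)
    rw [norm_smul]
    have := mul_le_mul_of_nonneg_left (hmod' t (s / N)) (norm_nonneg (k s))
    refine this.trans_eq ?_
    rw [abs_div, abs_of_pos hN0]
    ring
  have hSη : S * η' ≤ η / 4 := by
    rw [hη', ← mul_div_assoc, div_le_div_iff₀ (by positivity) (by positivity)]
    nlinarith
  have hKN : K / N * S1 ≤ η / 4 := by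
    rw [hN, div_mul_eq_mul_div, div_le_iff₀ (by positivity)]
    have : η / 4 * (4 * (K * S1 + 1) / η) = K * S1 + 1 := by field_simp
    rw [this]
    linarith
  rw [hsub] at h1
  have h3 : ‖v t‖ ≤ ‖∫ s, k s • v (t + s / N)‖ + ‖(∫ s, k s • v (t + s / N)) - v t‖ := by
    have := norm_sub_le (∫ s, k s • v (t + s / N)) ((∫ s, k s • v (t + s / N)) - v t)
    simpa using this
  linarith

end Periodization

/-! ### Asymptotic periodicity of the periodized function -/

section PeriodizedSolution

variable {X : Type*} [NormedAddCommGroup X] [NormedSpace ℂ X]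

lemma integral_fourier_smul_forward_diff {χ : ℝ → ℂ} (hχ : ContDiff ℝ ∞ χ)
    (hχc : HasCompactSupport χ) {y : ℝ → X} (hy : Continuous y) {C : ℝ} (hC : ∀ t, ‖y t‖ ≤ C)
    (t : ℝ) :
    ∫ s, 𝓕 χ s • (y (t + s + 1) - y (t + s))
      = ∫ s, 𝓕 (fun x : ℝ => (Complex.exp (2 * Real.pi * x * Complex.I) - 1) * χ x) s
          • y (t + s) := by
  have hk := integrable_fourier_of_test hχ hχc
  have hi : Integrable χ := hχ.continuous.integrable_of_hasCompactSupport hχc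
  have hker := fourier_exp_line_sub_one_smul hi
  simp only [smul_eq_mul] at hker
  simp only [hker, sub_smul, smul_sub]
  have h1 : Integrable (fun s => 𝓕 χ s • y (t + s + 1)) := by
    simpa only [add_assoc, add_comm, add_left_comm] using
      integrable_smul_translate hk hy hC (t + 1)
  rw [integral_sub h1 (integrable_smul_translate hk hy hC t),
    integral_sub (integrable_smul_translate (hk.comp_sub_right 1) hy hC t)
      (integrable_smul_translate hk hy hC t)]
  congr 1
  rw [← integral_sub_right_eq_self (fun s => 𝓕 χ s • y (t + s + 1)) 1]
  refine integral_congr_ae (Eventually.of_forall fun s => ?_)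
  simp only [add_assoc, sub_add_cancel]

/-- The kernel of `χ` convolved with the periodized comb. -/
lemma tsum_periodCoeff_mul_fourier {δ : ℝ} (hδ : 0 < δ) {χ : ℝ → ℂ} (hχ : ContDiff ℝ ∞ χ)
    (hχc : HasCompactSupport χ) {F : Finset ℤ}
    (hF : ∀ n : ℤ, n ∉ F → ∀ x : ℝ, χ x * cutoff ((x + n) / δ) = 0) (s : ℝ) :
    ∑' m : ℤ, periodCoeff δ m * 𝓕 χ (s - m)
      = ∑ n ∈ F, 𝓕 (fun x => χ x * cutoff ((x + n) / δ)) s := by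
  have hi : Integrable χ := hχ.continuous.integrable_of_hasCompactSupport hχc
  set f : ℤ → ℝ → ℂ := fun m x => Complex.exp (↑(-2 * Real.pi * x * s) * Complex.I) *
    (periodCoeff δ m * (Complex.exp (2 * Real.pi * (m * x) * Complex.I) * χ x)) with hf
  have hfi : ∀ m, Integrable (f m) := fun m => by
    have h1 := integrable_phase_smul hi (θ := fun x => 2 * Real.pi * (m * x)) (by fun_prop)
    have h2 := integrable_phase_smul (h1.const_mul (periodCoeff δ m))
      (θ := fun x => -2 * Real.pi * x * s) (by fun_prop)
    refine h2.congr (Eventually.of_forall fun x => ?_)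
    simp only [hf, smul_eq_mul]
    push_cast
    rfl
  have hfn : ∀ m x, ‖f m x‖ = ‖periodCoeff δ m‖ * ‖χ x‖ := fun m x => by
    simp only [hf, norm_mul, Complex.norm_exp_ofReal_mul_I, one_mul]
    congr 1
    have : (2 * Real.pi * (m * x) * Complex.I : ℂ) = ↑(2 * Real.pi * (m * x) : ℝ) * Complex.I := by
      push_cast
      rfl
    rw [this, Complex.norm_exp_ofReal_mul_I, one_mul]
  have hsum := hasSum_integral_of_summable_integral_norm hfi (by
    simp only [hfn, integral_const_mul]
    exact (summable_norm_periodCoeff hδ).mul_right _)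
  have hterm : ∀ m : ℤ, ∫ x, f m x = periodCoeff δ m * 𝓕 χ (s - m) := fun m => by
    have := fourier_exp_line_smul χ m s
    rw [← this, Real.fourier_real_eq_integral_exp_smul, ← integral_const_mul]
    refine integral_congr_ae (Eventually.of_forall fun x => ?_)
    simp only [hf, smul_eq_mul, Complex.ofReal_intCast]
    ring
  simp only [hterm] at hsum
  rw [hsum.tsum_eq]
  have hpt : ∀ x, ∑' m, f m x = ∑ n ∈ F, Complex.exp (↑(-2 * Real.pi * x * s) * Complex.I) •
      (χ x * cutoff ((x + n) / δ)) := fun x => by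
    have e1 : ∀ m, f m x = Complex.exp (↑(-2 * Real.pi * x * s) * Complex.I) * χ x *
        (periodCoeff δ m * Complex.exp (2 * Real.pi * (m * x) * Complex.I)) := fun m => by
      simp only [hf]
      ring
    simp only [e1]
    rw [tsum_mul_left, tsum_periodCoeff_mul_exp hδ, ← tsum_mul_left, tsum_eq_sum (s := F)]
    · exact Finset.sum_congr rfl fun n _ => by rw [smul_eq_mul]; ring
    · intro n hn
      rw [mul_assoc, hF n hn x, mul_zero]
  simp only [hpt]
  rw [integral_finsetSum]
  · simp only [Real.fourier_real_eq_integral_exp_smul]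
  · intro n _
    refine integrable_phase_smul (Continuous.integrable_of_hasCompactSupport ?_ hχc.mul_right)
      (by fun_prop)
    have := hχ.continuous
    have := contDiff_cutoff.continuous
    fun_prop

variable [CompleteSpace X]

/-- The translations in the periodization are shifted onto the kernel, where they sum to the
periodic multiplier; χ meets only finitely many of its bumps. -/
lemma integral_fourier_smul_periodization {δ : ℝ} (hδ : 0 < δ) {χ : ℝ → ℂ} (hχ : ContDiff ℝ ∞ χ)
    (hχc : HasCompactSupport χ) {F : Finset ℤ}
    (hF : ∀ n : ℤ, n ∉ F → ∀ x : ℝ, χ x * cutoff ((x + n) / δ) = 0)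
    {u : ℝ → X} (hu : Continuous u) {C : ℝ} (hC : ∀ t, ‖u t‖ ≤ C) (t : ℝ) :
    ∫ s, 𝓕 χ s • periodization δ u (t + s)
      = ∑ n ∈ F, ∫ s, 𝓕 (fun x => χ x * cutoff ((x + n) / δ)) s • u (t + s) := by
  have hk := integrable_fourier_of_test hχ hχc
  obtain ⟨D, hD0, hD⟩ := fourier_decay_of_test hχ hχc 0
  have hbd : ∀ s, ‖𝓕 χ s‖ ≤ D := fun s => by simpa using hD s
  set f : ℤ → ℝ → X := fun m s => periodCoeff δ m • (𝓕 χ s • u (t + s + m)) with hf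
  set g : ℤ → ℝ → X := fun m s => periodCoeff δ m • (𝓕 χ (s - m) • u (t + s)) with hg
  have hfi : ∀ m, Integrable (f m) := fun m => by
    refine Integrable.smul _ ?_
    simpa only [add_assoc, add_comm, add_left_comm] using
      integrable_smul_translate hk hu hC (t + m)
  have hgi : ∀ m, Integrable (g m) := fun m =>
    (integrable_smul_translate (hk.comp_sub_right (m : ℝ)) hu hC t).smul _
  have hfg : ∀ m, ∫ s, f m s = ∫ s, g m s := fun m => by
    rw [← integral_sub_right_eq_self (f m) (m : ℝ)]
    refine integral_congr_ae (Eventually.of_forall fun s => ?_)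
    simp only [hf, hg, add_assoc, sub_add_cancel]
  have hsumm : Summable fun m : ℤ => ‖periodCoeff δ m‖ * ((∫ s, ‖𝓕 χ s‖) * C) :=
    (summable_norm_periodCoeff hδ).mul_right _
  have hfs := hasSum_integral_of_summable_integral_norm hfi (by
    refine hsumm.of_nonneg_of_le (fun m => integral_nonneg fun _ => norm_nonneg _) fun m => ?_
    rw [← integral_mul_const, ← integral_const_mul]
    refine integral_mono (hfi m).norm ((hk.norm.mul_const C).const_mul _) fun s => ?_
    simp only [hf, norm_smul]
    gcongr
    exact hC _)
  have hgs := hasSum_integral_of_summable_integral_norm hgi (by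
    refine hsumm.of_nonneg_of_le (fun m => integral_nonneg fun _ => norm_nonneg _) fun m => ?_
    rw [← integral_sub_right_eq_self (fun s => ‖𝓕 χ s‖) (m : ℝ), ← integral_mul_const,
      ← integral_const_mul]
    refine integral_mono (hgi m).norm (((hk.comp_sub_right (m : ℝ)).norm.mul_const C).const_mul _)
      fun s => ?_
    simp only [hg, norm_smul]
    gcongr
    exact hC _)
  simp only [hfg] at hfs
  have key := hfs.unique hgs
  have e1 : ∀ s, ∑' m, f m s = 𝓕 χ s • periodization δ u (t + s) := fun s => by
    simp only [hf, periodization, smul_comm _ (𝓕 χ s)]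
    exact (summable_periodCoeff_smul hδ fun m => hC _).tsum_const_smul _
  have e2 : ∀ s, ∑' m, g m s
      = ∑ n ∈ F, 𝓕 (fun x => χ x * cutoff ((x + n) / δ)) s • u (t + s) := fun s => by
    rw [← Finset.sum_smul, ← tsum_periodCoeff_mul_fourier hδ hχ hχc hF]
    simp only [hg, ← mul_smul]
    refine Summable.tsum_smul_const ?_ _
    refine Summable.of_norm_bounded ((summable_norm_periodCoeff hδ).mul_right D) fun m => ?_
    rw [norm_mul]
    exact mul_le_mul_of_nonneg_left (hbd _) (norm_nonneg _)
  simp only [e1, e2] at key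
  rw [key, integral_finsetSum]
  intro n _
  refine integrable_smul_translate (integrable_fourier_of_test ?_ hχc.mul_right) hu hC t
  exact hχ.mul (contDiff_cutoff.comp ((contDiff_id.add contDiff_const).div_const δ))

/-- If the spectrum of `u` is reduced to the integers near the integers, then the periodization of
`u` is asymptotically `1`-periodic. -/
lemma tendsto_periodization_forward_diff {u : ℝ → X} (hu : UniformContinuous u) {C : ℝ}
    (hC : ∀ t, ‖u t‖ ≤ C) {δ : ℝ} (hδ : 0 < δ)
    (hloc : ∀ (p : ℤ) (χ : ℝ → ℂ), ContDiff ℝ ∞ χ → HasCompactSupport χ →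
      tsupport χ ⊆ Metric.closedBall (p : ℝ) (2 * δ) \ {(p : ℝ)} →
      Tendsto (fun t => ∫ s, 𝓕 χ s • u (t + s)) atTop (𝓝 0)) :
    Tendsto (fun t => periodization δ u (t + 1) - periodization δ u t) atTop (𝓝 0) := by
  set S := ∑' m : ℤ, ‖periodCoeff δ m‖
  have hP := uniformContinuous_periodization hδ hu hC
  have hPC : ∀ t, ‖periodization δ u t‖ ≤ S * C := fun t =>
    norm_tsum_periodCoeff_smul_le hδ fun m => hC _
  refine tendsto_zero_of_bandlimited (C := S * C + S * C)
    ((hP.comp (uniformContinuous_id.add uniformContinuous_const)).sub hP)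
    (fun t => (norm_sub_le _ _).trans (add_le_add (hPC _) (hPC _))) fun N hN => ?_
  have hNs := contDiff_cutoff_div N
  have hNc := hasCompactSupport_cutoff_div hN
  simp only [integral_fourier_smul_forward_diff hNs hNc hP.continuous hPC]
  set e : ℝ → ℂ := fun x => Complex.exp (2 * Real.pi * x * Complex.I) - 1 with he
  have hes : ContDiff ℝ ∞ e := contDiff_exp_line.sub contDiff_const
  -- A nonzero product needs |x| < 2N and |x + n| < 2δ, hence |n| < 2N + 2δ.
  set M : ℤ := ⌈2 * N + 2 * δ⌉ with hM
  have hF : ∀ n : ℤ, n ∉ Finset.Icc (-M) M → ∀ x : ℝ,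
      (e x * cutoff (x / N)) * cutoff ((x + n) / δ) = 0 := by
    intro n hn x
    rcases le_or_gt (2 * N) |x| with hx | hx
    · rw [cutoff_div_eq_zero hN hx, mul_zero, zero_mul]
    rcases le_or_gt (2 * δ) |x + n| with hx2 | hx2
    · rw [cutoff_div_eq_zero hδ hx2, mul_zero]
    exfalso
    refine hn (Finset.mem_Icc.2 (abs_le.1 ?_))
    have h1 : |(n : ℝ)| ≤ |x + n| + |x| := by
      have := abs_sub (x + n) x
      simpa using this
    have h2 : |(n : ℝ)| ≤ M := (h1.trans (by linarith)).trans (Int.le_ceil _)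
    exact_mod_cast h2
  have hId := integral_fourier_smul_periodization hδ (χ := fun x => e x * cutoff (x / N))
    (hes.mul hNs) hNc.mul_left hF hu.continuous hC
  have hgoal : Tendsto (fun t => ∫ s, 𝓕 (fun x => e x * cutoff (x / N)) s
      • periodization δ u (t + s)) atTop (𝓝 0) := by
    simp only [hId]
    rw [← Finset.sum_const_zero (s := Finset.Icc (-M) M)]
    refine tendsto_finsetSum _ fun n _ => ?_
    have hbs : ContDiff ℝ ∞ (fun x : ℝ => cutoff (x / N) * cutoff ((x + n) / δ)) :=
      hNs.mul (contDiff_cutoff.comp ((contDiff_id.add contDiff_const).div_const δ))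
    -- The bump with index n is centred at the integer -n.
    have h := tendsto_integral_fourier_of_isolated hu.continuous hC (hloc (-n)) hbs
      hNc.mul_right (by
        refine closure_minimal (fun x hx => ?_) Metric.isClosed_closedBall
        rw [Function.mem_support] at hx
        rw [Metric.mem_closedBall, Real.dist_eq]
        by_contra hlt
        refine hx ?_
        rw [cutoff_div_eq_zero hδ, mul_zero]
        push_cast at hlt
        rw [sub_neg_eq_add] at hlt
        exact (not_le.1 hlt).le)
    simp only [mul_assoc (e _)]
    exact h
  exact hgoal

end PeriodizedSolution

/-! ### Functions on the half line and their even extensions -/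

section HalfLine

lemma tendsto_comp_abs {Y : Type*} {v : ℝ → Y} {l : Filter Y} (hv : Tendsto v atTop l) :
    Tendsto (fun t => v |t|) atTop l :=
  hv.comp tendsto_abs_atTop_atTop

variable {X : Type*} [NormedAddCommGroup X]

lemma IsBUC.uniformContinuous_comp_abs {v : ℝ → X} (hv : IsBUC v) :
    UniformContinuous fun t => v |t| := by
  have habs : UniformContinuous fun t : ℝ => |t| := uniformContinuous_norm
  have h := hv.1.comp (f := fun t : ℝ => |t|) (s := univ)
    (uniformContinuousOn_univ.2 habs) (fun t _ => abs_nonneg t)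
  exact uniformContinuousOn_univ.1 h

lemma IsBUC.of_uniformContinuous {v : ℝ → X} (hv : UniformContinuous v) {C : ℝ}
    (hC : ∀ t, ‖v t‖ ≤ C) : IsBUC v :=
  ⟨hv.uniformContinuousOn, C, fun t _ => hC t⟩

lemma IsBUC.add {v w : ℝ → X} (hv : IsBUC v) (hw : IsBUC w) : IsBUC (fun t => v t + w t) := by
  obtain ⟨C, hC⟩ := hv.2
  obtain ⟨D, hD⟩ := hw.2
  refine ⟨?_, C + D, fun t ht => (norm_add_le _ _).trans (add_le_add (hC t ht) (hD t ht))⟩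
  have h1 := uniformContinuousOn_iff_restrict.1 hv.1
  have h2 := uniformContinuousOn_iff_restrict.1 hw.1
  exact uniformContinuousOn_iff_restrict.2 (h1.add h2)

lemma IsBUC.neg {v : ℝ → X} (hv : IsBUC v) : IsBUC (fun t => -v t) := by
  obtain ⟨C, hC⟩ := hv.2
  refine ⟨?_, C, fun t ht => by rw [norm_neg]; exact hC t ht⟩
  exact uniformContinuousOn_iff_restrict.2 (uniformContinuousOn_iff_restrict.1 hv.1).neg

lemma IsBUC.sub {v w : ℝ → X} (hv : IsBUC v) (hw : IsBUC w) : IsBUC (fun t => v t - w t) := by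
  simpa only [sub_eq_add_neg] using hv.add hw.neg

lemma IsBUC.of_tendsto_zero {v : ℝ → X} (hv : ContinuousOn v (Ici 0))
    (h0 : Tendsto v atTop (𝓝 0)) : IsBUC v := by
  constructor
  · have hc : Continuous fun t : ℝ => v |t| :=
      hv.comp_continuous continuous_abs fun t => abs_nonneg t
    -- The even extension vanishes at both ends of the line, which gives uniform continuity at once.
    have hu := hc.uniformContinuous_of_tendsto_cocompact (h0.comp tendsto_norm_cocompact_atTop)
    exact hu.uniformContinuousOn.congr fun t ht => by
      beta_reduce
      rw [abs_of_nonneg ht]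
  · obtain ⟨T, hT⟩ := Metric.tendsto_atTop.1 h0 1 one_pos
    obtain ⟨D, hD⟩ := (isCompact_Icc (a := (0 : ℝ)) (b := T)).exists_bound_of_continuousOn
      (hv.mono fun t ht => ht.1)
    refine ⟨max D 1, fun t ht => ?_⟩
    rcases le_total t T with h | h
    · exact (hD t ⟨ht, h⟩).trans (le_max_left _ _)
    · have := hT t h
      rw [dist_zero_right] at this
      exact this.le.trans (le_max_right _ _)

lemma IsBUC.clm [NormedSpace ℂ X] {v : ℝ → X} (hv : IsBUC v) (A : X →L[ℂ] X) :
    IsBUC (fun t => A (v t)) := by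
  obtain ⟨C, hC⟩ := hv.2
  exact ⟨A.uniformContinuous.comp_uniformContinuousOn hv.1, ‖A‖ * C,
    fun t ht => A.le_of_opNorm_le_of_le le_rfl (hC t ht)⟩

lemma tendsto_int_translate_sub {f : ℝ → X} (h : Tendsto (fun t => f (t + 1) - f t) atTop (𝓝 0))
    (m : ℤ) : Tendsto (fun t => f (t + m) - f t) atTop (𝓝 0) := by
  induction m with
  | zero => simp
  | succ n ih =>
    have h1 := h.comp (tendsto_atTop_add_const_right atTop (n : ℝ) tendsto_id)
    have h2 := h1.add ih
    rw [add_zero] at h2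
    refine h2.congr fun t => ?_
    simp only [Function.comp, id]
    push_cast
    rw [add_assoc]
    abel
  | pred n ih =>
    have h1 := h.comp (tendsto_atTop_add_const_right atTop (-(n : ℝ) - 1) tendsto_id)
    have h2 := ih.sub h1
    rw [sub_zero] at h2
    refine h2.congr fun t => ?_
    simp only [Function.comp, id]
    push_cast
    rw [show t + (-(n : ℝ) - 1) + 1 = t + -n by ring]
    abel

end HalfLine

/-! ### Commuting the fractional integral with periodization -/

section FracIntegralPeriodization

variable {X : Type*} [NormedAddCommGroup X] [NormedSpace ℂ X] {α : ℝ}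

lemma fracIntegral_congr {v w : ℝ → X} {t : ℝ} (ht : 0 ≤ t) (h : ∀ s, 0 ≤ s → v s = w s) :
    fracIntegral α v t = fracIntegral α w t := by
  refine intervalIntegral.integral_congr fun s hs => ?_
  rw [uIcc_of_le ht] at hs
  rw [h s hs.1]

lemma fracIntegral_sub (hα0 : 0 < α) {v w : ℝ → X} {t : ℝ} (ht : 0 ≤ t)
    (hv : ContinuousOn v (Ici 0)) (hw : ContinuousOn w (Ici 0)) :
    fracIntegral α (fun s => v s - w s) t = fracIntegral α v t - fracIntegral α w t := by
  have hsub : uIcc 0 t ⊆ Ici (0 : ℝ) := by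
    rw [uIcc_of_le ht]
    exact Icc_subset_Ici_self
  simp only [fracIntegral, smul_sub]
  exact intervalIntegral.integral_sub (intervalIntegrable_rlKernel_smul hα0 (hv.mono hsub))
    (intervalIntegrable_rlKernel_smul hα0 (hw.mono hsub))

lemma fracIntegral_clm [CompleteSpace X] (hα0 : 0 < α) (A : X →L[ℂ] X) {v : ℝ → X} {t : ℝ}
    (ht : 0 ≤ t) (hv : ContinuousOn v (Ici 0)) :
    fracIntegral α (fun s => A (v s)) t = A (fracIntegral α v t) := by
  have hsub : uIcc 0 t ⊆ Ici (0 : ℝ) := by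
    rw [uIcc_of_le ht]
    exact Icc_subset_Ici_self
  rw [fracIntegral, fracIntegral, ← ContinuousLinearMap.intervalIntegral_comp_comm A
    (intervalIntegrable_rlKernel_smul hα0 (hv.mono hsub))]
  refine intervalIntegral.integral_congr fun s _ => ?_
  rw [← Complex.coe_smul, ← Complex.coe_smul, map_smul]

/-- The substitution τ = ts gives t^α ∫₀¹ (1 - s)^(α-1)/Γ(α) v(ts) ds, where neither the range nor
the singularity moves with t and dominated convergence applies. -/
lemma continuousOn_fracIntegral (hα0 : 0 < α) {v : ℝ → X} (hv : Continuous v) {C : ℝ}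
    (hC : ∀ t, ‖v t‖ ≤ C) : ContinuousOn (fracIntegral α v) (Ici 0) := by
  have hΓ : 0 < Real.Gamma α := Real.Gamma_pos_of_pos hα0
  have hcont : Continuous fun t : ℝ =>
      t ^ α • ∫ s in (0 : ℝ)..1, ((1 - s) ^ (α - 1) / Real.Gamma α) • v (t * s) := by
    refine Continuous.smul (M := ℝ) (continuous_id.rpow_const fun _ => Or.inr hα0.le) ?_
    refine intervalIntegral.continuous_of_dominated_interval
      (bound := fun s => (1 - s) ^ (α - 1) / Real.Gamma α * C) (fun t => ?_) (fun t => ?_)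
      ((intervalIntegrable_rlKernel hα0 1 0 1).mul_const C) ?_
    · refine AEStronglyMeasurable.smul (𝕜 := ℝ) ?_
        (hv.comp (continuous_const.mul continuous_id)).aestronglyMeasurable
      exact (by fun_prop : Measurable fun s : ℝ =>
        (1 - s) ^ (α - 1) / Real.Gamma α).aestronglyMeasurable
    · refine Eventually.of_forall fun s hs => ?_
      rw [uIoc_of_le zero_le_one] at hs
      have h1 : 0 ≤ 1 - s := by linarith [hs.2]
      rw [norm_smul, Real.norm_of_nonneg (by positivity)]
      exact mul_le_mul_of_nonneg_left (hC _) (by positivity)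
    · refine Eventually.of_forall fun s _ => ?_
      exact (hv.comp (continuous_id.mul continuous_const)).const_smul _
  refine hcont.continuousOn.congr fun t ht => ?_
  rcases eq_or_lt_of_le (mem_Ici.1 ht) with rfl | ht
  · simp [fracIntegral, Real.zero_rpow hα0.ne']
  have h := intervalIntegral.integral_comp_mul_left (a := 0) (b := 1)
    (fun τ => ((t - τ) ^ (α - 1) / Real.Gamma α) • v τ) ht.ne'
  rw [mul_zero, mul_one, eq_inv_smul_iff₀ ht.ne'] at h
  rw [fracIntegral, ← h]
  have e1 : t ^ α = t * t ^ (α - 1) := by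
    rw [Real.rpow_sub_one ht.ne']
    field_simp
  beta_reduce
  rw [e1, mul_smul]
  congr 1
  rw [← intervalIntegral.integral_smul]
  refine intervalIntegral.integral_congr fun s hs => ?_
  rw [uIcc_of_le zero_le_one] at hs
  rw [smul_smul, ← mul_one_sub, Real.mul_rpow ht.le (by linarith [hs.2]), mul_div_assoc]

lemma fracIntegral_translate (v : ℝ → X) (m t : ℝ) :
    fracIntegral α (fun s => v (s + m)) t
      = ∫ s in m..(t + m), ((t + m - s) ^ (α - 1) / Real.Gamma α) • v s := by
  have h := intervalIntegral.integral_comp_add_right (a := 0) (b := t)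
    (fun s => ((t + m - s) ^ (α - 1) / Real.Gamma α) • v s) m
  rw [zero_add] at h
  rw [← h, fracIntegral]
  refine intervalIntegral.integral_congr fun s _ => ?_
  rw [add_sub_add_right_eq_sub]

lemma fracIntegral_translate_sub (hα0 : 0 < α) {v : ℝ → X} (hv : Continuous v) (m t : ℝ) :
    fracIntegral α (fun s => v (s + m)) t - fracIntegral α v (t + m)
      = ∫ s in m..0, ((t + m - s) ^ (α - 1) / Real.Gamma α) • v s := by
  rw [fracIntegral_translate, fracIntegral, sub_eq_iff_eq_add]
  exact (intervalIntegral.integral_add_adjacent_intervals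
    (intervalIntegrable_rlKernel_smul hα0 hv.continuousOn)
    (intervalIntegrable_rlKernel_smul hα0 hv.continuousOn)).symm

lemma rpow_le_one_add (hα0 : 0 < α) (hα1 : α ≤ 1) {x : ℝ} (hx : 0 ≤ x) : x ^ α ≤ 1 + x := by
  rcases le_total x 1 with h | h
  · exact (Real.rpow_le_one hx h hα0.le).trans (by linarith)
  · exact (Real.rpow_le_rpow_of_exponent_le h hα1).trans (by rw [Real.rpow_one]; linarith)

lemma norm_fracIntegral_le (hα0 : 0 < α) {v : ℝ → X} {C : ℝ} (hC : ∀ t, ‖v t‖ ≤ C) {t : ℝ}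
    (ht : 0 ≤ t) : ‖fracIntegral α v t‖ ≤ C / Real.Gamma (α + 1) * t ^ α := by
  refine (norm_integral_rlKernel_le hα0 hC ht le_rfl).trans_eq ?_
  rw [sub_zero, sub_self, Real.zero_rpow hα0.ne', sub_zero]
  ring

/-- The discrepancy is an integral over the interval between 0 and m; subadditivity of x ↦ x^α for α
≤ 1 bounds its kernel mass uniformly in t. -/
lemma norm_fracIntegral_translate_sub_le (hα0 : 0 < α) (hα1 : α ≤ 1) {v : ℝ → X}
    (hv : Continuous v) {C : ℝ} (hC : ∀ t, ‖v t‖ ≤ C) {m t : ℝ} (ht : 0 ≤ t) (hmt : 0 ≤ t + m) :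
    ‖fracIntegral α (fun s => v (s + m)) t - fracIntegral α v (t + m)‖
      ≤ C / Real.Gamma (α + 1) * |m| ^ α := by
  have hΓ : 0 < Real.Gamma (α + 1) := Real.Gamma_pos_of_pos (by linarith)
  have hC0 : 0 ≤ C := (norm_nonneg _).trans (hC 0)
  rw [fracIntegral_translate_sub hα0 hv, div_mul_eq_mul_div, mul_div_assoc]
  rcases le_total m 0 with hm | hm
  · refine (norm_integral_rlKernel_le hα0 hC hm hmt).trans ?_
    gcongr
    rw [add_sub_cancel_right, sub_zero, abs_of_nonpos hm]
    have := Real.rpow_add_le_add_rpow hmt (neg_nonneg.2 hm) hα0.le hα1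
    rw [add_neg_cancel_right] at this
    linarith
  · rw [intervalIntegral.integral_symm, norm_neg]
    refine (norm_integral_rlKernel_le hα0 hC hm (by linarith)).trans ?_
    gcongr
    rw [add_sub_cancel_right, sub_zero, abs_of_nonneg hm]
    have := Real.rpow_add_le_add_rpow ht hm hα0.le hα1
    linarith

lemma exists_tendsto_rlKernel (hα1 : α ≤ 1) :
    ∃ κ : ℝ, Tendsto (fun x : ℝ => x ^ (α - 1) / Real.Gamma α) atTop (𝓝 κ) := by
  rcases hα1.eq_or_lt with rfl | h
  · exact ⟨1 / Real.Gamma 1, by simp⟩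
  · refine ⟨0 / Real.Gamma α, Tendsto.div_const ?_ _⟩
    have := tendsto_rpow_neg_atTop (y := 1 - α) (by linarith)
    simpa using this

/-- On the fixed interval between 0 and m the kernel tends to a constant κ, which is 0 for α < 1 and
1 for α = 1, so the limit is κ ∫ v from m to 0. -/
lemma exists_tendsto_fracIntegral_translate_sub (hα0 : 0 < α) (hα1 : α ≤ 1) {v : ℝ → X}
    (hv : Continuous v) {C : ℝ} (hC : ∀ t, ‖v t‖ ≤ C) (m : ℝ) :
    ∃ l : X, Tendsto (fun t => fracIntegral α (fun s => v (s + m)) t - fracIntegral α v (t + m))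
      atTop (𝓝 l) := by
  have hΓ : 0 < Real.Gamma α := Real.Gamma_pos_of_pos hα0
  obtain ⟨κ, hκ⟩ := exists_tendsto_rlKernel (α := α) hα1
  refine ⟨∫ s in m..0, κ • v s, ?_⟩
  simp only [fracIntegral_translate_sub hα0 hv]
  refine intervalIntegral.tendsto_integral_filter_of_dominated_convergence
    (fun _ => 1 / Real.Gamma α * C) (Eventually.of_forall fun t => ?_) ?_
    intervalIntegrable_const (Eventually.of_forall fun s _ => ?_)
  · refine AEStronglyMeasurable.smul (𝕜 := ℝ) ?_ hv.aestronglyMeasurable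
    exact (by fun_prop : Measurable fun s : ℝ =>
        (t + m - s) ^ (α - 1) / Real.Gamma α).aestronglyMeasurable
  · filter_upwards [eventually_ge_atTop (1 + |m|)] with t ht
    refine Eventually.of_forall fun s hs => ?_
    have hs' : s ≤ max m 0 := hs.2
    have h1 : 1 ≤ t + m - s := by
      have h2 : max m 0 ≤ m + |m| := by
        rcases le_total m 0 with h | h
        · rw [max_eq_right h, abs_of_nonpos h]; linarith
        · rw [max_eq_left h, abs_of_nonneg h]; linarith
      linarith
    rw [norm_smul, Real.norm_of_nonneg (by positivity)]
    gcongr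
    · exact Real.rpow_le_one_of_one_le_of_nonpos h1 (by linarith)
    · exact hC s
  · refine Tendsto.smul_const (hκ.comp ?_) _
    simp only [add_sub_assoc]
    exact tendsto_atTop_add_const_right _ _ tendsto_id

variable [CompleteSpace X]

lemma fracIntegral_periodization (hα0 : 0 < α) {δ : ℝ} (hδ : 0 < δ) {v : ℝ → X}
    (hv : Continuous v) {C : ℝ} (hC : ∀ t, ‖v t‖ ≤ C) {t : ℝ} (ht : 0 ≤ t) :
    fracIntegral α (periodization δ v) t
      = ∑' m : ℤ, periodCoeff δ m • fracIntegral α (fun s => v (s + m)) t := by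
  have hΓ : 0 < Real.Gamma α := Real.Gamma_pos_of_pos hα0
  have h := intervalIntegral.hasSum_integral_of_dominated_convergence (μ := volume) (a := 0)
    (b := t) (F := fun (m : ℤ) s => periodCoeff δ m •
      (((t - s) ^ (α - 1) / Real.Gamma α) • v (s + m)))
    (f := fun s => ((t - s) ^ (α - 1) / Real.Gamma α) • periodization δ v s)
    (fun m s => ‖periodCoeff δ m‖ * ((t - s) ^ (α - 1) / Real.Gamma α * C))
    (fun m => ?_) (fun m => ?_) ?_ ?_ ?_
  · rw [fracIntegral, ← h.tsum_eq]
    refine tsum_congr fun m => ?_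
    rw [intervalIntegral.integral_smul]
    rfl
  · refine AEStronglyMeasurable.const_smul (AEStronglyMeasurable.smul (𝕜 := ℝ) ?_
      (hv.comp (continuous_add_const _)).aestronglyMeasurable) _
    exact (by fun_prop : Measurable fun s : ℝ =>
        (t - s) ^ (α - 1) / Real.Gamma α).aestronglyMeasurable
  · refine Eventually.of_forall fun s hs => ?_
    rw [uIoc_of_le ht] at hs
    have h1 : 0 ≤ t - s := by linarith [hs.2]
    rw [norm_smul, norm_smul, Real.norm_of_nonneg (by positivity)]
    gcongr
    exact hC _
  · exact Eventually.of_forall fun s _ => (summable_norm_periodCoeff hδ).mul_right _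
  · simp only [tsum_mul_right]
    exact ((intervalIntegrable_rlKernel hα0 t 0 t).mul_const C).const_mul _
  · refine Eventually.of_forall fun s _ => ?_
    simp only [smul_comm (periodCoeff δ _)]
    exact (summable_periodCoeff_smul hδ fun m => hC _).hasSum.const_smul _

/-- The fractional integral commutes with periodization up to a convergent term. -/
lemma exists_tendsto_fracIntegral_periodization (hα0 : 0 < α) (hα1 : α ≤ 1) {δ : ℝ} (hδ : 0 < δ)
    {u v : ℝ → X} {D : ℝ} (hD : ∀ t, ‖u t‖ ≤ D)
    (hv : Continuous v) {C : ℝ} (hC : ∀ t, ‖v t‖ ≤ C)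
    (huv : ∀ t, 0 ≤ t → u t = fracIntegral α v t + u 0) :
    ∃ l : X, Tendsto (fun t => fracIntegral α (periodization δ v) t - periodization δ u t)
      atTop (𝓝 l) := by
  have hΓ : 0 < Real.Gamma (α + 1) := Real.Gamma_pos_of_pos (by linarith)
  have hC0 : 0 ≤ C := (norm_nonneg _).trans (hC 0)
  have hD0 : 0 ≤ D := (norm_nonneg _).trans (hD 0)
  set E : ℝ → ℤ → X := fun t m => fracIntegral α (fun s => v (s + m)) t - u (t + m) with hE
  set K : ℝ := C / Real.Gamma (α + 1) + D with hK
  have hK0 : 0 ≤ K := by positivity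
  have hEb : ∀ t, 0 ≤ t → ∀ m, ‖E t m‖ ≤ K * (1 + |(m : ℝ)|) := by
    intro t ht m
    have hm0 := abs_nonneg (m : ℝ)
    have hpow := rpow_le_one_add hα0 hα1 hm0
    have hCΓ : 0 ≤ C / Real.Gamma (α + 1) := by positivity
    -- For t + m ≥ 0 the equation for u is available at t + m. Otherwise t < |m|, and the crude
    -- bound by t^α is already of order |m|^α.
    rcases le_or_gt 0 (t + m) with hmt | hmt
    · have e1 : E t m = (fracIntegral α (fun s => v (s + m)) t - fracIntegral α v (t + m))
          - u 0 := by
        simp only [hE]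
        rw [huv _ hmt]
        abel
      rw [e1]
      refine (norm_sub_le _ _).trans ((add_le_add
        (norm_fracIntegral_translate_sub_le hα0 hα1 hv hC ht hmt) (hD 0)).trans ?_)
      have := mul_le_mul_of_nonneg_left hpow hCΓ
      have := mul_nonneg hD0 hm0
      rw [hK]
      linarith
    · refine (norm_sub_le _ _).trans ((add_le_add
        (norm_fracIntegral_le hα0 (v := fun s => v (s + m)) (fun s => hC _) ht) (hD _)).trans ?_)
      have h1 : t ^ α ≤ |(m : ℝ)| ^ α := by
        refine Real.rpow_le_rpow ht ?_ hα0.le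
        have := neg_le_abs (m : ℝ)
        linarith
      have := mul_le_mul_of_nonneg_left (h1.trans hpow) hCΓ
      have := mul_nonneg hD0 hm0
      rw [hK]
      linarith
  have hsumb : Summable fun m : ℤ => ‖periodCoeff δ m‖ * (K * (1 + |(m : ℝ)|)) := by
    refine ((summable_periodCoeff_mul hδ).mul_left K).congr fun m => ?_
    ring
  have hEs : ∀ t, 0 ≤ t → Summable fun m : ℤ => periodCoeff δ m • E t m := fun t ht =>
    Summable.of_norm_bounded hsumb fun m => by
      rw [norm_smul]
      exact mul_le_mul_of_nonneg_left (hEb t ht m) (norm_nonneg _)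
  choose l hl using fun m : ℤ => exists_tendsto_fracIntegral_translate_sub hα0 hα1 hv hC (m : ℝ)
  refine ⟨∑' m : ℤ, periodCoeff δ m • (l m - u 0), ?_⟩
  have hlim : Tendsto (fun t => ∑' m : ℤ, periodCoeff δ m • E t m) atTop
      (𝓝 (∑' m : ℤ, periodCoeff δ m • (l m - u 0))) := by
    refine tendsto_tsum_of_dominated_convergence hsumb (fun m => Tendsto.const_smul ?_ _) ?_
    · refine ((hl m).sub_const (u 0)).congr' ?_
      filter_upwards [eventually_ge_atTop (-(m : ℝ))] with t ht
      simp only [hE]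
      rw [huv (t + m) (by linarith)]
      abel
    · filter_upwards [eventually_ge_atTop (0 : ℝ)] with t ht m
      rw [norm_smul]
      exact mul_le_mul_of_nonneg_left (hEb t ht m) (norm_nonneg _)
  refine hlim.congr' ?_
  filter_upwards [eventually_ge_atTop (0 : ℝ)] with t ht
  have hus := summable_periodCoeff_smul hδ (y := fun m : ℤ => u (t + m)) fun m => hD _
  rw [fracIntegral_periodization hα0 hδ hv hC ht, periodization, eq_sub_iff_add_eq,
    ← (hEs t ht).tsum_add hus]
  refine tsum_congr fun m => ?_
  rw [← smul_add]
  simp only [hE, sub_add_cancel]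

end FracIntegralPeriodization

/-! ### The spectral gap at the integers and the new solution -/

section Main

variable {X : Type*} [NormedAddCommGroup X] [NormedSpace ℂ X]

lemma isUnit_symbolOp_of_mem {α : ℝ} {A : X →L[ℂ] X} {x : ℝ}
    (hx : (2 * Real.pi * x * Complex.I : ℂ) ∈ fracResolventSet A α) : IsUnit (symbolOp α A x) := by
  obtain ⟨R, -, hR⟩ := hx
  obtain ⟨h1, h2⟩ := hR.self_of_nhds
  exact ⟨⟨_, _, h1, h2⟩, rfl⟩

/-- Near each integer, the symbol is invertible at all other points. -/
lemma exists_radius_isUnit_symbolOp {α : ℝ} {A : X →L[ℂ] X}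
    (hclosed : IsClosed ((Complex.exp '' fracImagSpectrum A α) \ {1})) :
    ∃ r : ℝ, 0 < r ∧ ∀ (p : ℤ) (x : ℝ), x ≠ p → |x - p| < r →
      (∀ n : ℤ, x ≠ n) ∧ IsUnit (symbolOp α A x) := by
  have hnhds : ((Complex.exp '' fracImagSpectrum A α) \ {1})ᶜ ∈ 𝓝 (1 : ℂ) :=
    hclosed.isOpen_compl.mem_nhds fun h => h.2 rfl
  have hcont : Tendsto (fun y : ℝ => Complex.exp (2 * Real.pi * y * Complex.I)) (𝓝 0) (𝓝 1) :=
    Continuous.tendsto' (by fun_prop) _ _ (by simp)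
  obtain ⟨ρ, hρ, h⟩ := Metric.mem_nhds_iff.1 (hcont hnhds)
  -- Radius at most 1 excludes the other integers; ρ serves every p because x ↦ e^(2πix) has period
  -- 1.
  refine ⟨min ρ 1, lt_min hρ one_pos, fun p x hxp hx => ?_⟩
  have hint : ∀ n : ℤ, x ≠ n := by
    rintro n rfl
    have h1 := hx.trans_le (min_le_right _ _)
    have h2 : |n - p| < 1 := by exact_mod_cast h1
    rw [Int.abs_lt_one_iff, sub_eq_zero] at h2
    exact hxp (by rw [h2])
  refine ⟨hint, isUnit_symbolOp_of_mem ?_⟩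
  have hmem : x - p ∈ Metric.ball (0 : ℝ) ρ := by
    rw [mem_ball_zero_iff]
    exact hx.trans_le (min_le_left _ _)
  have h1 := h hmem
  have hexp : Complex.exp (2 * Real.pi * ((x - p : ℝ) : ℂ) * Complex.I)
      = Complex.exp (2 * Real.pi * x * Complex.I) := by
    rw [Complex.exp_eq_exp_iff_exists_int]
    refine ⟨-p, ?_⟩
    push_cast
    ring
  rw [mem_preimage, hexp] at h1
  by_contra hnot
  refine h1 ⟨⟨_, ⟨?_, hnot⟩, rfl⟩, ?_⟩
  · simp
  · rw [mem_singleton_iff, exp_line_eq_one_iff]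
    rintro ⟨n, hn⟩
    exact hint n hn

variable [CompleteSpace X]

/-- The coefficients sum to 1, so the difference is a series of integer increments f(t + m) - f(t),
each tending to 0. -/
lemma tendsto_periodization_sub_self {δ : ℝ} (hδ : 0 < δ) (hδ1 : 2 * δ ≤ 1) {f : ℝ → X} {C : ℝ}
    (hC : ∀ t, ‖f t‖ ≤ C) (hper : Tendsto (fun t => f (t + 1) - f t) atTop (𝓝 0)) :
    Tendsto (fun t => periodization δ f t - f t) atTop (𝓝 0) := by
  have h : Tendsto (fun t => ∑' m : ℤ, periodCoeff δ m • (f (t + m) - f t)) atTop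
      (𝓝 (∑' _ : ℤ, (0 : X))) := by
    refine tendsto_tsum_of_dominated_convergence
      ((summable_norm_periodCoeff hδ).mul_right (C + C)) (fun m => ?_)
      (Eventually.of_forall fun t m => ?_)
    · simpa using (tendsto_int_translate_sub hper m).const_smul (periodCoeff δ m)
    · rw [norm_smul]
      exact mul_le_mul_of_nonneg_left ((norm_sub_le _ _).trans (add_le_add (hC _) (hC _)))
        (norm_nonneg _)
  rw [tsum_zero] at h
  refine h.congr fun t => ?_
  simp only [smul_sub]
  rw [(summable_periodCoeff_smul hδ (y := fun m : ℤ => f (t + m)) fun m => hC _).tsum_sub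
    (summable_periodCoeff_smul hδ (y := fun _ => f t) fun _ => hC t),
    (summable_norm_periodCoeff hδ).of_norm.tsum_smul_const, tsum_periodCoeff hδ hδ1, one_smul]
  rfl

/-- Periodizing an asymptotic mild solution yields an asymptotically periodic one. -/
theorem IsAsymptoticMildSolution.exists_isAsymptoticOnePeriodic {α : ℝ} (hα0 : 0 < α)
    (hα1 : α ≤ 1) {A : X →L[ℂ] X}
    (hclosed : IsClosed ((Complex.exp '' fracImagSpectrum A α) \ {1})) {f : ℝ → X}
    (hf : IsAsymptoticOnePeriodic f) {u : ℝ → X} (hu : IsAsymptoticMildSolution α A f u) :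
    ∃ u₁ : ℝ → X, IsAsymptoticMildSolution α A f u₁ ∧ IsAsymptoticOnePeriodic u₁ := by
  obtain ⟨huB, ε, ⟨hεB, hε0⟩, -, hmild⟩ := hu
  obtain ⟨hfB, hfper⟩ := hf
  -- even extensions to the whole line
  obtain ⟨Cu, hCu⟩ := huB.2
  obtain ⟨Cf, hCf⟩ := hfB.2
  obtain ⟨Ce, hCe⟩ := hεB.2
  set C := max Cu (max Cf Ce) with hCdef
  set U : ℝ → X := fun t => u |t| with hU
  set f' : ℝ → X := fun t => f |t| with hf'
  set ε' : ℝ → X := fun t => ε |t| with hε'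
  have hUC : ∀ t, ‖U t‖ ≤ C := fun t => (hCu _ (abs_nonneg t)).trans (le_max_left _ _)
  have hfC : ∀ t, ‖f' t‖ ≤ C := fun t =>
    (hCf _ (abs_nonneg t)).trans ((le_max_left _ _).trans (le_max_right _ _))
  have hεC : ∀ t, ‖ε' t‖ ≤ C := fun t =>
    (hCe _ (abs_nonneg t)).trans ((le_max_right _ _).trans (le_max_right _ _))
  have hUu : UniformContinuous U := huB.uniformContinuous_comp_abs
  have hfu : UniformContinuous f' := hfB.uniformContinuous_comp_abs
  have hεu : UniformContinuous ε' := hεB.uniformContinuous_comp_abs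
  have hε0' : Tendsto ε' atTop (𝓝 0) := tendsto_comp_abs hε0
  have hfper' : Tendsto (fun t => f' (t + 1) - f' t) atTop (𝓝 0) := by
    refine hfper.congr' ?_
    filter_upwards [eventually_ge_atTop (0 : ℝ)] with t ht
    simp only [hf', abs_of_nonneg ht, abs_of_nonneg (by linarith : 0 ≤ t + 1)]
  set G : ℝ → X := fun t => A (U t) + f' t + ε' t with hG
  have hAUu : UniformContinuous fun t => A (U t) := A.uniformContinuous.comp hUu
  have hGu : UniformContinuous G := (hAUu.add hfu).add hεu
  have hAUC : ∀ t, ‖A (U t)‖ ≤ ‖A‖ * C := fun t => A.le_of_opNorm_le_of_le le_rfl (hUC t)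
  have hGC : ∀ t, ‖G t‖ ≤ ‖A‖ * C + C + C := fun t =>
    norm_add₃_le.trans (add_le_add (add_le_add (hAUC t) (hfC t)) (hεC t))
  have hsol : ∀ t, 0 ≤ t → U t = fracIntegral α G t + U 0 := by
    intro t ht
    have h1 := hmild t ht
    have hucont : ContinuousOn u (Ici 0) := huB.1.continuousOn
    have h2 : fracIntegral α (fun s => f s + ε s) t
        = fracIntegral α G t - fracIntegral α (fun s => A (u s)) t := by
      rw [← fracIntegral_sub (w := fun s => A (u s)) hα0 ht hGu.continuous.continuousOn
        (A.continuous.comp_continuousOn hucont)]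
      refine fracIntegral_congr ht fun s hs => ?_
      simp only [hG, hU, hf', hε', abs_of_nonneg hs]
      abel
    rw [h2, fracIntegral_clm hα0 A ht hucont] at h1
    simp only [hU, abs_of_nonneg ht, abs_zero]
    rw [h1]
    abel
  -- the cutoff radius
  obtain ⟨r, hr, hunit⟩ := exists_radius_isUnit_symbolOp hclosed
  -- 2δ < r keeps each bump inside the spectrum-free neighbourhood of its integer, and 2δ ≤ 1 makes
  -- the coefficients sum to 1.
  set δ : ℝ := min (r / 4) (1 / 2) with hδdef
  have hδ : 0 < δ := lt_min (by linarith) (by norm_num)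
  have hδ1 : 2 * δ ≤ 1 := by linarith [min_le_right (r / 4) (1 / 2 : ℝ)]
  have hδr : 2 * δ < r := by linarith [min_le_left (r / 4) (1 / 2 : ℝ)]
  have hPper : Tendsto (fun t => periodization δ U (t + 1) - periodization δ U t) atTop (𝓝 0) := by
    refine tendsto_periodization_forward_diff hUu hUC hδ fun p χ hχ hχc hχS => ?_
    refine tendsto_integral_fourier_of_resolvent hα0 hα1 A hUu.continuous hfu.continuous
      hεu.continuous hUC hfC hεC hfper' hε0' (fun t ht => hsol t ht.le) hχ hχc fun x hx => ?_
    obtain ⟨h1, h2⟩ := hχS hx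
    rw [Metric.mem_closedBall, Real.dist_eq] at h1
    exact hunit p x h2 (h1.trans_lt hδr)
  -- the new solution
  obtain ⟨l, hl⟩ := exists_tendsto_fracIntegral_periodization hα0 hα1 hδ hUC hGu.continuous hGC hsol
  set P := periodization δ U with hP
  set H := periodization δ G with hH
  have hPu : UniformContinuous P := uniformContinuous_periodization hδ hUu hUC
  have hHu : UniformContinuous H := uniformContinuous_periodization hδ hGu hGC
  have hPC := fun t => norm_tsum_periodCoeff_smul_le hδ (y := fun m : ℤ => U (t + m)) fun m => hUC _
  have hHC := fun t => norm_tsum_periodCoeff_smul_le hδ (y := fun m : ℤ => G (t + m)) fun m => hGC _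
  -- `P` need not satisfy an integral equation exactly. This function differs from it by o(1), and
  -- since J^α H vanishes at 0 the constant -l is its initial value.
  set u₁ : ℝ → X := fun t => fracIntegral α H t - l with hu₁
  have hu₁c : ContinuousOn u₁ (Ici 0) :=
    (continuousOn_fracIntegral hα0 hHu.continuous hHC).sub continuousOn_const
  have hdiff : Tendsto (fun t => u₁ t - P t) atTop (𝓝 0) := by
    have := hl.sub_const l
    rw [sub_self] at this
    refine this.congr fun t => ?_
    simp only [hu₁]
    abel
  have hu₁B : IsBUC u₁ := by
    have h1 := (IsBUC.of_tendsto_zero (hu₁c.sub hPu.continuous.continuousOn) hdiff).add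
      (IsBUC.of_uniformContinuous hPu hPC)
    simpa using h1
  have hu₁0 : u₁ 0 = -l := by simp [hu₁, fracIntegral]
  -- Forced by H = A u₁ + f + ε₁. It tends to 0 because H is A P plus the periodizations of f and ε,
  -- and A(u₁ - P) → 0.
  set ε₁ : ℝ → X := fun t => H t - A (u₁ t) - f t with hε₁
  have hε₁B : IsBUC ε₁ := ((IsBUC.of_uniformContinuous hHu hHC).sub (hu₁B.clm A)).sub hfB
  have hε₁0 : Tendsto ε₁ atTop (𝓝 0) := by
    have h1 : Tendsto (fun t => A (u₁ t - P t)) atTop (𝓝 0) := by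
      have := (A.continuous.tendsto 0).comp hdiff
      rwa [map_zero] at this
    have h2 := tendsto_periodization_sub_self hδ hδ1 hfC hfper'
    have h3 := tendsto_periodization_zero hδ hεC hε0'
    have h4 := (h2.add h3).sub h1
    rw [add_zero, sub_zero] at h4
    refine h4.congr' ?_
    filter_upwards [eventually_ge_atTop (0 : ℝ)] with t ht
    have e1 : H t = A (P t) + periodization δ f' t + periodization δ ε' t := by
      have s1 := summable_periodCoeff_smul hδ (y := fun m : ℤ => U (t + m)) fun m => hUC _
      have s2 := summable_periodCoeff_smul hδ (y := fun m : ℤ => f' (t + m)) fun m => hfC _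
      have s3 := summable_periodCoeff_smul hδ (y := fun m : ℤ => ε' (t + m)) fun m => hεC _
      have s1' := s1.mapL A
      simp only [hH, hP, periodization]
      rw [A.map_tsum s1, ← s1'.tsum_add s2, ← (s1'.add s2).tsum_add s3]
      refine tsum_congr fun m => ?_
      simp only [hG, smul_add, map_smul]
    simp only [hε₁, e1, map_sub, hf', abs_of_nonneg ht]
    abel
  refine ⟨u₁, ⟨hu₁B, ε₁, ⟨hε₁B, hε₁0⟩, hu₁c, fun t ht => ?_⟩, hu₁B, ?_⟩
  · have e1 : fracIntegral α (fun s => f s + ε₁ s) t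
        = fracIntegral α H t - A (fracIntegral α u₁ t) := by
      rw [← fracIntegral_clm hα0 A ht hu₁c, ← fracIntegral_sub (w := fun s => A (u₁ s)) hα0 ht
        hHu.continuous.continuousOn (A.continuous.comp_continuousOn hu₁c)]
      refine fracIntegral_congr ht fun s _ => ?_
      simp only [hε₁]
      abel
    rw [e1, hu₁0]
    simp only [hu₁]
    abel
  · have h1 := hdiff.comp (tendsto_atTop_add_const_right atTop (1 : ℝ) tendsto_id)
    have h2 := (h1.add hPper).sub hdiff
    rw [add_zero, sub_zero] at h2
    refine h2.congr fun t => ?_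
    simp only [Function.comp, id]
    abel

end Main

theorem mainTheorem2 {X : Type*} [NormedAddCommGroup X] [NormedSpace ℂ X] [CompleteSpace X]
    (α : ℝ) (hα0 : 0 < α) (hα1 : α ≤ 1)
    (A : X →L[ℂ] X)
    (hclosed : IsClosed ((Complex.exp '' fracImagSpectrum A α) \ {1}))
    (f : ℝ → X) (hf : IsAsymptoticOnePeriodic f) :
    (∃ u : ℝ → X, IsAsymptoticMildSolution α A f u ∧ IsAsymptoticOnePeriodic u) ↔
      (∃ u : ℝ → X, IsAsymptoticMildSolution α A f u) :=
  ⟨fun ⟨u, hu, _⟩ => ⟨u, hu⟩,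
    fun ⟨_, hu⟩ => hu.exists_isAsymptoticOnePeriodic hα0 hα1 hclosed hf⟩
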